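/- Let $\alpha>1$, let $K_1,\dots,K_d>0$, and let $V=(V_1,\dots,V_d)^\top$ be a random vector with values in $[0,\infty)^d$ such that $\mathbb P(V_j>t)/(K_jt^{-\alpha})\to1$ as $t\to\infty$ for every $j$. Assume that $V$ is multivariate regularly varying with intensity measure $\mu$: $\mu$ is a nonzero Radon measure on $[0,\infty]^d\setminus\{0\}$ with $\mu([0,\infty]^d\setminus[0,\infty)^d)=0$, and $\mathbb P(V\in t\,\cdot\,)/\mathbb P(\|V\|>t)\to\mu$ vaguely on $[0,\infty]^d\setminus\{0\}$ as $t\to\infty$, for some norm $\|\cdot\|$ on $\mathbb R^d$. The components of $V$ are called asymptotically independent if $\mu$ is concentrated on the coordinate axes, and asymptotically fully dependent if $\mu$ is concentrated on the ray $\{sK^{1/\alpha}\mathbf 1:s>0\}$, where $K^{1/\alpha}=\mathrm{diag}(K_1^{1/\alpha},\dots,K_d^{1/\alpha})$ and $\mathbf 1=(1,\dots,1)^\top\in\mathbb R^d$. Let $W$ be a random $q\times d$ matrix with entries in $[0,\infty)$ and $\mathbb E\|W\|^{\alpha+\delta}<\infty$ for some matrix norm and some $\delta>0$, and let $\sim$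 be a random bipartite graph between $\{1,\dots,q\}$ and $\{1,\dots,d\}$ with $W_{ij}>0$ whenever $i\sim j$. Assume that $V$ is independent of the pair consisting of $W$ and the graph. Put $A_{ij}=W_{ij}\mathbf 1(i\sim j)$ and $F=AV$. Let $g,h:[0,\infty)^q\to[0,\infty)$ be continuous and $1$-homogeneous, and let $$C^h_{\rm ind}=\sum_{j=1}^dK_j\,\mathbb E\,h^\alpha(Ae_j),\qquad C^h_{\rm dep}=\mathbb E\,h^\alpha(AK^{1/\alpha}\mathbf 1).$$ In the situations of (a) and (b) below, $g(F)$ is integrable, $\mathbb P(h(F)>t)>0$ for all $t$, and all the expectations in the formulas are finite. (a) If $V_1,\dots,V_d$ are asymptotically independent and $C^h_{\rm ind}>0$, then $$\lim_{t\to\infty}\frac{\mathbb E[g(F)\mid h(F)>t]}{t}=\frac{\alpha}{\alpha-1}\,(C^h_{\rm ind})^{-1}\sum_{j=1}^d\mathbb E\big[g(AK^{1/\alpha}e_j)\,h^{\alpha-1}(AK^{1/\alpha}e_j)\big].$$ (b) If $V_1,\dots,V_d$ are asymptotically fully dependent and $C^h_{\rm dep}>0$, then $$\lim_{t\to\infty}\frac{\mathbb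 E[g(F)\mid h(F)>t]}{t}=\frac{\alpha}{\alpha-1}\,(C^h_{\rm dep})^{-1}\,\mathbb E\big[g(AK^{1/\alpha}\mathbf 1)\,h^{\alpha-1}(AK^{1/\alpha}\mathbf 1)\big].$$ (c) For $g=h$ this gives the classical asymptotics of the conditional tail expectation: with $C=C^h_{\rm ind}$ in the situation of (a) and $C=C^h_{\rm dep}$ in the situation of (b), $$\mathbb E[h(F)\mid h(F)>t]\sim\frac{\alpha}{\alpha-1}\,t\quad(t\to\infty),$$ $$\mathrm{CoTE}_{1-\gamma}(h(F))\sim\frac{\alpha}{\alpha-1}\,\mathrm{VaR}_{1-\gamma}(h(F))\sim\frac{\alpha}{\alpha-1}\,C^{1/\alpha}\gamma^{-1/\alpha}\quad(\gamma\downarrow0),$$ where $\mathrm{VaR}_{1-\gamma}(X)=\inf\{t\ge0:\mathbb P(X>t)\le\gamma\}$ and $\mathrm{CoTE}_{1-\gamma}(X)=\mathbb E[X\mid X>\mathrm{VaR}_{1-\gamma}(X)]$. -/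

import Mathlib

open MeasureTheory ProbabilityTheory Filter Topology Asymptotics
open scoped NNReal ENNReal Matrix CompactlySupported

noncomputable section

namespace SystemicRisk

/-- The punctured compactified orthant `[0,∞]^d \ {0}`, with the subspace topology of the product
`[0,∞]^d` (so that its relatively compact subsets are those bounded away from `0`) and the
corresponding Borel σ-algebra. -/
abbrev PuncturedOrthant (d : ℕ) : Type := {x : Fin d → ℝ≥0∞ // x ≠ 0}

/-- The measure `ℙ(X ∈ t · )` on the Borel sets of `[0,∞]^d \ {0}`, for `t > 0`. -/
def scaledLaw {Ω : Type*} [MeasurableSpace Ω] {d : ℕ} (P : Measure Ω) (X : Ω → Fin d → ℝ≥0)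
    (t : ℝ) : Measure (PuncturedOrthant d) :=
  (P.map fun ω j => (X ω j : ℝ≥0∞) / ENNReal.ofReal t).comap Subtype.val

/-- `X` is multivariate regularly varying with intensity measure `μ` (with respect to the norm
`N`): `μ` is a nonzero Radon measure on `[0,∞]^d \ {0}` that does not charge the points with an
infinite coordinate, and `ℙ(X ∈ t · ) / ℙ(N X > t)` converges vaguely to `μ` as `t → ∞`. -/
structure IsRegularlyVarying {Ω : Type*} [MeasurableSpace Ω] {d : ℕ} (P : Measure Ω)
    (N : Seminorm ℝ (Fin d → ℝ)) (X : Ω → Fin d → ℝ≥0) (μ : Measure (PuncturedOrthant d)) :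
    Prop where
  radon : μ.Regular
  ne_zero : μ ≠ 0
  infinite_null : μ {x | ∃ j, x.1 j = ∞} = 0
  vague : ∀ f : C_c(PuncturedOrthant d, ℝ),
    Tendsto (fun t : ℝ => (∫ x, f x ∂(scaledLaw P X t)) /
        P.real {ω | t < N (fun j => (X ω j : ℝ))})
      atTop (𝓝 (∫ x, f x ∂μ))

/-- Asymptotic independence of the components: the intensity measure is concentrated on the
coordinate axes. -/
def AsymptoticallyIndependent {d : ℕ} (μ : Measure (PuncturedOrthant d)) : Prop :=
  ∀ᵐ x ∂μ, ∃ j, ∀ i, i ≠ j → x.1 i = 0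

/-- Asymptotic full dependence of the components: the intensity measure is concentrated on the
ray `{s K^{1/α} 1 : s > 0}`. -/
def AsymptoticallyFullyDependent {d : ℕ} (K : Fin d → ℝ≥0) (α : ℝ)
    (μ : Measure (PuncturedOrthant d)) : Prop :=
  ∀ᵐ x ∂μ, ∃ s : ℝ≥0, 0 < s ∧ ∀ j, x.1 j = ((s * K j ^ (1 / α) : ℝ≥0) : ℝ≥0∞)

open Classical in
/-- The weighted adjacency matrix `A_{ij} = W_{ij} 1(i ∼ j)`. -/
def weightedAdjacency {q d : ℕ} (W : Matrix (Fin q) (Fin d) ℝ≥0) (adj : Fin q → Fin d → Prop) :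
    Matrix (Fin q) (Fin d) ℝ≥0 :=
  Matrix.of fun i j => if adj i j then W i j else 0

/-- The diagonal matrix `K^{1/α} = diag(K_1^{1/α}, …, K_d^{1/α})`. -/
def diagRoot {d : ℕ} (K : Fin d → ℝ≥0) (α : ℝ) : Matrix (Fin d) (Fin d) ℝ≥0 :=
  Matrix.diagonal fun j => K j ^ (1 / α)

/-- `C^h_ind = ∑_j K_j 𝔼[h^α(A e_j)]`. -/
def constInd {Ω : Type*} [MeasurableSpace Ω] {q d : ℕ} (P : Measure Ω)
    (A : Ω → Matrix (Fin q) (Fin d) ℝ≥0) (K : Fin d → ℝ≥0) (α : ℝ)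
    (h : (Fin q → ℝ≥0) → ℝ≥0) : ℝ :=
  ∑ j, (K j : ℝ) * ∫ ω, (h (A ω *ᵥ Pi.single j 1) : ℝ) ^ α ∂P

/-- `C^h_dep = 𝔼[h^α(A K^{1/α} 1)]`. -/
def constDep {Ω : Type*} [MeasurableSpace Ω] {q d : ℕ} (P : Measure Ω)
    (A : Ω → Matrix (Fin q) (Fin d) ℝ≥0) (K : Fin d → ℝ≥0) (α : ℝ)
    (h : (Fin q → ℝ≥0) → ℝ≥0) : ℝ :=
  ∫ ω, (h ((A ω * diagRoot K α) *ᵥ 1) : ℝ) ^ α ∂P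

/-- `𝔼[Y ∣ S]`, the expectation of `Y` under the elementary conditional probability `ℙ( · ∣ S)`. -/
def condMean {Ω : Type*} [MeasurableSpace Ω] (P : Measure Ω) (Y : Ω → ℝ) (S : Set Ω) : ℝ :=
  ∫ ω, Y ω ∂(ProbabilityTheory.cond P S)

/-- `VaR_{1-γ}(X) = inf {t ≥ 0 : ℙ(X > t) ≤ γ}`. -/
def valueAtRisk {Ω : Type*} [MeasurableSpace Ω] (P : Measure Ω) (X : Ω → ℝ) (γ : ℝ) : ℝ :=
  sInf {t : ℝ | 0 ≤ t ∧ P.real {ω | t < X ω} ≤ γ}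

/-- `CoTE_{1-γ}(X) = 𝔼[X ∣ X > VaR_{1-γ}(X)]`. -/
def condTailExpectation {Ω : Type*} [MeasurableSpace Ω] (P : Measure Ω) (X : Ω → ℝ) (γ : ℝ) : ℝ :=
  condMean P X {ω | valueAtRisk P X γ < X ω}

/-- The classical asymptotics of the conditional tail expectation of `X` with tail index `α` and
tail constant `C`: `𝔼[X ∣ X > t] ∼ α/(α-1) t` as `t → ∞`, and
`CoTE_{1-γ}(X) ∼ α/(α-1) VaR_{1-γ}(X) ∼ α/(α-1) C^{1/α} γ^{-1/α}` as `γ ↓ 0`. -/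
def ClassicalCoTEAsymptotics {Ω : Type*} [MeasurableSpace Ω] (P : Measure Ω) (X : Ω → ℝ)
    (α C : ℝ) : Prop :=
  (fun t : ℝ => condMean P X {ω | t < X ω}) ~[atTop] (fun t : ℝ => α / (α - 1) * t) ∧
  (fun γ : ℝ => condTailExpectation P X γ) ~[𝓝[>] 0]
    (fun γ : ℝ => α / (α - 1) * valueAtRisk P X γ) ∧
  (fun γ : ℝ => α / (α - 1) * valueAtRisk P X γ) ~[𝓝[>] 0]
    (fun γ : ℝ => α / (α - 1) * (C ^ (1 / α) * γ ^ (-1 / α)))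

end SystemicRisk

end

/-! The extremes of `V` come from finitely many rays. Dividing `V_j` by `K_j^{1/α}` gives a variable
with tail `t^{-α}`. Under asymptotic independence one such variable drives each axis, in the
direction `K_j^{1/α} e_j`; under full dependence a single one drives the direction `K^{1/α} 1`. Up
to events of probability `o(t^{-α})`, on `∑ V_k ≤ L t`, the vector `V` is within `η t` of one ray
point `Z_j u_j` while the other `Z_i` are at most `η t` (`RayApproximation`). Vague convergence
enters only through test functions whose `μ`-integral vanishes
(`IsRegularlyVarying.tendsto_tail_zero`): the normalization of `μ` plays no role, since the
constants come from the marginal tails.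

For continuous 1-homogeneous `H` this gives `t^α P(H(V) > t) → ∑_j H(u_j)^α`
(`RayApproximation.tendsto_tail`). Freezing `A`, which is independent of `V`, and integrating over
it by dominated convergence gives `t^α P(h(AV) > t) → ∑_j E h(A u_j)^α`
(`RayApproximation.tendsto_mixture_tail`).

Joint tails reduce to the same statement: `{g(F) > s t, h(F) > t}` is `{min(g/s, h)(F) > t}`, and
`min(g/s, h)` is again continuous and 1-homogeneous. The layer-cake formula writes `E[g(F); h(F) >
t]` as `t` times the integral over `s` of these probabilities, and `∫₀^∞ min(x/s, y)^α ds = α/(α-1)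
· x y^{α-1}` turns the limit into the stated expectation. Dividing by `P(h(F) > t)` proves (a) and
(b). For `g = h` the constants cancel, and inverting the power tail gives the asymptotics of VaR and
hence of CoTE. -/

noncomputable section

namespace SystemicRisk

/-! ### Continuous 1-homogeneous functions on the orthant -/

/-- Positive homogeneity of degree one. -/
def PosHomogeneous {n : ℕ} (h : (Fin n → ℝ≥0) → ℝ≥0) : Prop :=
  ∀ (c : ℝ≥0) (x : Fin n → ℝ≥0), 0 < c → h (c • x) = c * h x

namespace PosHomogeneous

variable {n m : ℕ} {g h : (Fin n → ℝ≥0) → ℝ≥0}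

theorem map_zero (hh : PosHomogeneous h) : h 0 = 0 := by
  have h2 := hh 2 0 (by norm_num)
  rw [smul_zero] at h2
  have h3 : (h 0 : ℝ) = 2 * h 0 := by exact_mod_cast h2
  have h4 : (h 0 : ℝ) = 0 := by linarith
  exact_mod_cast h4

theorem smul (hh : PosHomogeneous h) (c : ℝ≥0) (x : Fin n → ℝ≥0) : h (c • x) = c * h x := by
  rcases eq_or_ne c 0 with rfl | hc
  · rw [zero_smul, zero_mul, hh.map_zero]
  · exact hh c x (pos_iff_ne_zero.2 hc)

theorem comp_mulVec (hh : PosHomogeneous h) (a : Matrix (Fin n) (Fin m) ℝ≥0) :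
    PosHomogeneous fun v => h (a *ᵥ v) := by
  intro c x hc
  beta_reduce
  rw [Matrix.mulVec_smul, hh c _ hc]

theorem min_div (hg : PosHomogeneous g) (hh : PosHomogeneous h) (s : ℝ≥0) :
    PosHomogeneous fun v => min (g v / s) (h v) := by
  intro c x hc
  beta_reduce
  rw [hg c x hc, hh c x hc, mul_div_assoc, mul_min]

theorem isCompact_box (L : ℝ≥0) : IsCompact {x : Fin n → ℝ≥0 | ∀ i, x i ≤ L} := by
  have : {x : Fin n → ℝ≥0 | ∀ i, x i ≤ L} = Set.Icc 0 (fun _ => L) := by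
    ext x
    simp [Set.mem_Icc, Pi.le_def]
  rw [this, ← Set.pi_univ_Icc]
  exact isCompact_univ_pi fun i => isCompact_Icc

/-- Dividing `x` by its coordinate sum puts it in the compact unit box, where `h` is bounded. -/
theorem exists_le_mul_sum (hh : PosHomogeneous h) (hc : Continuous h) :
    ∃ B : ℝ≥0, ∀ x, h x ≤ B * ∑ i, x i := by
  obtain ⟨B, hB⟩ := (isCompact_box (n := n) 1).bddAbove_image hc.continuousOn
  refine ⟨B, fun x => ?_⟩
  rcases eq_or_ne (∑ i, x i) 0 with h0 | h0
  · have : x = 0 := by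
      ext i
      have := (Finset.sum_eq_zero_iff.1 h0) i (Finset.mem_univ i)
      simp [this]
    rw [this, hh.map_zero]
    exact zero_le
  · have hx : x = (∑ i, x i) • ((∑ i, x i)⁻¹ • x) := by
      rw [smul_smul, mul_inv_cancel₀ h0, one_smul]
    have h1 : h ((∑ i, x i)⁻¹ • x) ≤ B := by
      refine hB ⟨_, fun i => ?_, rfl⟩
      rw [Pi.smul_apply, smul_eq_mul, inv_mul_le_iff₀ (pos_iff_ne_zero.2 h0), mul_one]
      exact Finset.single_le_sum (f := x) (fun _ _ => zero_le) (Finset.mem_univ i)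
    calc h x = (∑ i, x i) * h ((∑ i, x i)⁻¹ • x) := by
          conv_lhs => rw [hx]
          rw [hh.smul]
      _ ≤ (∑ i, x i) * B := by gcongr
      _ = B * ∑ i, x i := mul_comm _ _

/-- Uniform continuity on a compact box, rescaled by `t`: one `η` serves all levels `t`. -/
theorem exists_modulus (hh : PosHomogeneous h) (hc : Continuous h) (L : ℝ≥0) {ε : ℝ}
    (hε : 0 < ε) :
    ∃ η : ℝ, 0 < η ∧ ∀ t : ℝ, 0 < t → ∀ v w : Fin n → ℝ≥0,
      (∀ i, (v i : ℝ) ≤ L * t) → (∀ i, |(v i : ℝ) - w i| ≤ η * t) →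
      |(h v : ℝ) - h w| ≤ ε * t := by
  have huc := (isCompact_box (n := n) (L + 1)).uniformContinuousOn_of_continuous hc.continuousOn
  rw [Metric.uniformContinuousOn_iff_le] at huc
  obtain ⟨δ, hδ, H⟩ := huc ε hε
  -- The cap `1` keeps `t⁻¹ • w` inside the box of side `L + 1`.
  refine ⟨min δ 1, lt_min hδ one_pos, fun t ht v w hv hvw => ?_⟩
  lift t to ℝ≥0 using ht.le
  have ht' : 0 < t := by exact_mod_cast ht
  have hsc : ∀ x : Fin n → ℝ≥0, (h x : ℝ) = t * h (t⁻¹ • x) := by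
    intro x
    have : x = t • (t⁻¹ • x) := by rw [smul_smul, mul_inv_cancel₀ ht'.ne', one_smul]
    conv_lhs => rw [this]
    rw [hh.smul]; push_cast; rfl
  have key := H (t⁻¹ • v) (fun i => ?_) (t⁻¹ • w) (fun i => ?_) ?_
  · rw [NNReal.dist_eq] at key
    rw [hsc v, hsc w, ← mul_sub, abs_mul, abs_of_pos ht, mul_comm]
    gcongr
  · rw [Pi.smul_apply, smul_eq_mul, inv_mul_le_iff₀ ht']
    have := hv i
    have h2 : v i ≤ L * t := by exact_mod_cast this
    calc v i ≤ L * t := h2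
      _ ≤ t * (L + 1) := by rw [mul_add, mul_comm]; exact le_self_add
  · rw [Pi.smul_apply, smul_eq_mul, inv_mul_le_iff₀ ht', ← NNReal.coe_le_coe]
    have h1 := hv i
    have h2 := abs_le.1 (hvw i)
    have h3 : min δ 1 * (t : ℝ) ≤ t := by nlinarith [min_le_right δ 1]
    push_cast
    nlinarith
  · rw [dist_pi_le_iff hδ.le]
    intro i
    rw [NNReal.dist_eq, Pi.smul_apply, Pi.smul_apply, smul_eq_mul, smul_eq_mul]
    push_cast
    rw [← mul_sub, abs_mul, abs_of_pos (inv_pos.2 ht), inv_mul_le_iff₀ ht, mul_comm]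
    refine (hvw i).trans ?_
    gcongr
    exact min_le_left _ _

end PosHomogeneous

/-! ### Comparison of arbitrary norms with coordinate sums -/

section Seminorms

/-- A linear functional on a finite-dimensional space is dominated by every definite seminorm. -/
theorem exists_abs_le_mul_of_definite {E : Type*} [AddCommGroup E] [Module ℝ E]
    [FiniteDimensional ℝ E] (p : Seminorm ℝ E) (hp : ∀ x, p x = 0 → x = 0) (l : E →ₗ[ℝ] ℝ) :
    ∃ C : ℝ, 0 < C ∧ ∀ x, |l x| ≤ C * p x := by
  let : NormedAddCommGroup E := AddGroupNorm.toNormedAddCommGroup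
    { p.toAddGroupSeminorm with eq_zero_of_map_eq_zero' := fun x hx => hp x hx }
  let : NormedSpace ℝ E := ⟨fun a b => (map_smul_eq_mul p a b).le⟩
  refine ⟨‖LinearMap.toContinuousLinearMap l‖ + 1, by positivity, fun x => ?_⟩
  have h1 := (LinearMap.toContinuousLinearMap l).le_opNorm x
  have h2 : ‖x‖ = p x := rfl
  rw [h2] at h1
  have h3 : 0 ≤ p x := apply_nonneg p x
  calc |l x| = ‖(LinearMap.toContinuousLinearMap l) x‖ := rfl
    _ ≤ _ := h1
    _ ≤ _ := by nlinarith

theorem exists_le_mul_sum_abs {d : ℕ} (p : Seminorm ℝ (Fin d → ℝ)) :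
    ∃ C : ℝ, 0 < C ∧ ∀ x, p x ≤ C * ∑ i, |x i| := by
  refine ⟨∑ i, p (Pi.single i 1) + 1, by positivity, fun x => ?_⟩
  have hx : x = ∑ i, x i • (Pi.single i (1 : ℝ) : Fin d → ℝ) := by
    conv_lhs => rw [pi_eq_sum_univ' x]
  calc p x ≤ ∑ i, p (x i • (Pi.single i (1 : ℝ) : Fin d → ℝ)) := by
        conv_lhs => rw [hx]
        exact Finset.le_sum_of_subadditive p (map_zero p).le (map_add_le_add p) _ _
    _ = ∑ i, |x i| * p (Pi.single i 1) := by
        refine Finset.sum_congr rfl fun i _ => ?_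
        rw [map_smul_eq_mul, Real.norm_eq_abs]
    _ ≤ ∑ i, |x i| * (∑ i, p (Pi.single i 1) + 1) := by
        refine Finset.sum_le_sum fun i _ => ?_
        have : p (Pi.single i 1) ≤ ∑ i, p (Pi.single i (1 : ℝ)) :=
          Finset.single_le_sum (f := fun i => p (Pi.single i (1 : ℝ)))
            (fun _ _ => apply_nonneg p _) (Finset.mem_univ i)
        gcongr
        linarith
    _ = _ := by rw [← Finset.sum_mul, mul_comm]

end Seminorms

/-! ### Power tails: scaling and global bounds -/

section Tails

variable {Ω : Type*} [MeasurableSpace Ω] {P : Measure Ω} [IsProbabilityMeasure P] {α : ℝ}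

omit [IsProbabilityMeasure P] in
theorem tendsto_tail_of_div_tendsto_one {X : Ω → ℝ} {c : ℝ} (hc : c ≠ 0)
    (hX : Tendsto (fun t : ℝ => P.real {ω | t < X ω} / (c * t ^ (-α))) atTop (𝓝 1)) :
    Tendsto (fun t : ℝ => t ^ α * P.real {ω | t < X ω}) atTop (𝓝 c) := by
  have := hX.const_mul c
  rw [mul_one] at this
  refine this.congr' ?_
  filter_upwards [eventually_gt_atTop 0] with t ht
  rw [Real.rpow_neg ht.le]
  have : t ^ α ≠ 0 := (Real.rpow_pos_of_pos ht α).ne'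
  field_simp

omit [IsProbabilityMeasure P] in
theorem tendsto_tail_const_mul (hα : 0 < α) {X : Ω → ℝ} {l : ℝ}
    (hX : Tendsto (fun t : ℝ => t ^ α * P.real {ω | t < X ω}) atTop (𝓝 l)) {c : ℝ} (hc : 0 ≤ c) :
    Tendsto (fun t : ℝ => t ^ α * P.real {ω | t < c * X ω}) atTop (𝓝 (c ^ α * l)) := by
  rcases hc.eq_or_lt with rfl | hc
  · rw [Real.zero_rpow hα.ne', zero_mul]
    refine tendsto_const_nhds.congr' ?_
    filter_upwards [eventually_gt_atTop 0] with t ht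
    have : {ω : Ω | t < 0 * X ω} = ∅ := by
      ext ω; simp [ht.le]
    rw [this]; simp
  · have h1 : Tendsto (fun t : ℝ => t / c) atTop atTop := tendsto_id.atTop_div_const hc
    refine ((hX.comp h1).const_mul (c ^ α)).congr' ?_
    filter_upwards [eventually_gt_atTop 0] with t ht
    simp only [Function.comp]
    rw [Real.div_rpow ht.le hc.le, ← mul_assoc, mul_div_cancel₀ _ (Real.rpow_pos_of_pos hc α).ne']
    congr 3
    ext ω
    rw [div_lt_iff₀ hc, mul_comm]

/-- The limit controls large `t`; below the threshold `T` the probability is at most `1`. The global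
bound later supplies dominating functions. -/
theorem exists_tail_bound (hα : 0 < α) {X : Ω → ℝ} {l : ℝ}
    (hX : Tendsto (fun t : ℝ => t ^ α * P.real {ω | t < X ω}) atTop (𝓝 l)) :
    ∃ C : ℝ, ∀ t : ℝ, 0 < t → t ^ α * P.real {ω | t < X ω} ≤ C := by
  have h1 : ∀ᶠ t : ℝ in atTop, t ^ α * P.real {ω | t < X ω} ≤ l + 1 :=
    hX.eventually (eventually_le_nhds (by linarith))
  obtain ⟨T, hT⟩ := eventually_atTop.1 h1
  refine ⟨max (l + 1) (T ^ α), fun t ht => ?_⟩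
  rcases le_total T t with h | h
  · exact (hT t h).trans (le_max_left _ _)
  · refine le_trans ?_ (le_max_right _ _)
    calc t ^ α * P.real {ω | t < X ω} ≤ t ^ α * 1 := by
          gcongr
          exact measureReal_le_one
      _ ≤ T ^ α := by
          rw [mul_one]
          gcongr

/-- If `∑ V_j > t`, then `d V_j > t` for some `j`. -/
theorem exists_sum_tail_bound (hα : 0 < α) {d : ℕ} {V : Ω → Fin d → ℝ≥0} {l : Fin d → ℝ}
    (hV : ∀ j, Tendsto (fun t : ℝ => t ^ α * P.real {ω | t < (V ω j : ℝ)}) atTop (𝓝 (l j))) :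
    ∃ C : ℝ, 0 ≤ C ∧
      ∀ t : ℝ, 0 < t → t ^ α * P.real {ω | t < ((∑ j, V ω j : ℝ≥0) : ℝ)} ≤ C := by
  choose C hC using fun j => exists_tail_bound hα
    (tendsto_tail_const_mul hα (hV j) (Nat.cast_nonneg d))
  have hmain : ∀ t : ℝ, 0 < t →
      t ^ α * P.real {ω | t < ((∑ j, V ω j : ℝ≥0) : ℝ)} ≤ ∑ j, C j := by
    intro t ht
    have hsub : {ω | t < ((∑ j, V ω j : ℝ≥0) : ℝ)} ⊆ ⋃ j, {ω | t < d * (V ω j : ℝ)} := by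
      intro ω hω
      by_contra hcon
      simp only [Set.mem_iUnion, Set.mem_ofPred_eq, not_exists, not_lt] at hcon hω
      push_cast at hω
      rcases Nat.eq_zero_or_pos d with rfl | hd
      · simp at hω; linarith
      · have h1 : ∑ j, (d : ℝ) * (V ω j : ℝ) ≤ ∑ _j : Fin d, t := Finset.sum_le_sum fun j _ => hcon j
        rw [← Finset.mul_sum] at h1
        simp only [Finset.sum_const, Finset.card_univ, Fintype.card_fin, nsmul_eq_mul] at h1
        have hd' : (0 : ℝ) < d := by exact_mod_cast hd
        have := le_of_mul_le_mul_left h1 hd'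
        linarith
    calc t ^ α * P.real {ω | t < ((∑ j, V ω j : ℝ≥0) : ℝ)}
        ≤ t ^ α * ∑ j, P.real {ω | t < d * (V ω j : ℝ)} := by
          gcongr
          exact (measureReal_mono hsub).trans (measureReal_iUnion_fintype_le _)
      _ = ∑ j, t ^ α * P.real {ω | t < d * (V ω j : ℝ)} := Finset.mul_sum _ _ _
      _ ≤ _ := Finset.sum_le_sum fun j _ => hC j t ht
  refine ⟨∑ j, C j, le_trans ?_ (hmain 1 one_pos), hmain⟩
  positivity

omit [IsProbabilityMeasure P] in
/-- The scaling form of a global power bound on a tail. -/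
theorem tail_bound_const_mul (hα : 0 < α) {X : Ω → ℝ} {C : ℝ}
    (hX : ∀ t : ℝ, 0 < t → t ^ α * P.real {ω | t < X ω} ≤ C) {c : ℝ} (hc : 0 ≤ c) {t : ℝ}
    (ht : 0 < t) : t ^ α * P.real {ω | t < c * X ω} ≤ C * c ^ α := by
  rcases hc.eq_or_lt with rfl | hc
  · have : {ω : Ω | t < 0 * X ω} = ∅ := by
      ext ω; simp [ht.le]
    rw [this]
    simp [Real.zero_rpow hα.ne']
  · have h1 := hX (t / c) (div_pos ht hc)
    have h2 : {ω : Ω | t < c * X ω} = {ω | t / c < X ω} := by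
      ext ω
      rw [Set.mem_ofPred_eq, Set.mem_ofPred_eq, div_lt_iff₀ hc, mul_comm]
    rw [h2]
    rw [Real.div_rpow ht.le hc.le, div_mul_eq_mul_div, div_le_iff₀ (Real.rpow_pos_of_pos hc α)] at h1
    exact h1

end Tails

/-! ### Tails of homogeneous functions of a vector approximated by rays -/

section Rays

variable {Ω J : Type*} [MeasurableSpace Ω] {P : Measure Ω}
  {α : ℝ} {d : ℕ} {V : Ω → Fin d → ℝ≥0} {Z : J → Ω → ℝ≥0} {u : J → Fin d → ℝ≥0}

/-- The event that `V` is within `η t` of the point `Z j • u j`, all the other `Z i` being at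
most `η t`. -/
def nearRay (V : Ω → Fin d → ℝ≥0) (Z : J → Ω → ℝ≥0) (u : J → Fin d → ℝ≥0) (η t : ℝ) (j : J) :
    Set Ω :=
  {ω | (∀ k, |(V ω k : ℝ) - Z j ω * u j k| ≤ η * t) ∧ ∀ i, i ≠ j → (Z i ω : ℝ) ≤ η * t}

/-- The extremes of `V` are asymptotically those of one of the vectors `Z j • u j`, where each
`Z j` has a Pareto tail with index `α`. -/
structure RayApproximation (P : Measure Ω) (α : ℝ) (V : Ω → Fin d → ℝ≥0) (Z : J → Ω → ℝ≥0)
    (u : J → Fin d → ℝ≥0) : Prop where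
  measurable : ∀ j, Measurable (Z j)
  tail : ∀ j, Tendsto (fun t : ℝ => t ^ α * P.real {ω | t < (Z j ω : ℝ)}) atTop (𝓝 1)
  negligible : ∀ (η : ℝ) (L : ℝ≥0), 0 < η → Tendsto (fun t : ℝ => t ^ α * P.real
    {ω | ((∑ k, V ω k : ℝ≥0) : ℝ) ≤ L * t ∧ ¬ ∃ j, ω ∈ nearRay V Z u η t j}) atTop (𝓝 0)

theorem measurableSet_nearRay [Finite J] (hV : Measurable V) (hZ : ∀ j, Measurable (Z j))
    (η t : ℝ) (j : J) : MeasurableSet (nearRay V Z u η t j) := by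
  have hVk : ∀ k, Measurable fun ω => (V ω k : ℝ) := fun k =>
    ((measurable_pi_apply k).comp hV).coe_nnreal_real
  have hZr : ∀ i, Measurable fun ω => (Z i ω : ℝ) := fun i => (hZ i).coe_nnreal_real
  have h1 : nearRay V Z u η t j =
      (⋂ k, {ω | |(V ω k : ℝ) - Z j ω * u j k| ≤ η * t}) ∩
        ⋂ i, ⋂ (_ : i ≠ j), {ω | (Z i ω : ℝ) ≤ η * t} := by
    ext ω
    simp [nearRay]
  rw [h1]
  refine (MeasurableSet.iInter fun k => ?_).inter
    (MeasurableSet.iInter fun i => MeasurableSet.iInter fun _ => ?_)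
  · exact measurableSet_le (((hVk k).sub ((hZr j).mul_const _)).abs) measurable_const
  · exact measurableSet_le (hZr i) measurable_const

/-- The event on which the approximation by rays fails at level `t`. -/
def exceptional (V : Ω → Fin d → ℝ≥0) (Z : J → Ω → ℝ≥0) (u : J → Fin d → ℝ≥0) (L : ℝ≥0)
    (η t : ℝ) : Set Ω :=
  {ω | ¬ (((∑ k, V ω k : ℝ≥0) : ℝ) ≤ L * t ∧ ∃ j, ω ∈ nearRay V Z u η t j)}

/-- The order of quantifiers matters: `L` depends on `κ` only, so that `η` may afterwards be taken
from a modulus of continuity on the box of size `L`. The part `∑ V_k > L t` costs at most `C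
L^{-α}`, the rest is negligible. -/
theorem RayApproximation.eventually_exceptional_lt [IsProbabilityMeasure P] (hα : 0 < α)
    (hR : RayApproximation P α V Z u) {C : ℝ}
    (hS : ∀ t : ℝ, 0 < t → t ^ α * P.real {ω | t < ((∑ k, V ω k : ℝ≥0) : ℝ)} ≤ C)
    {κ : ℝ} (hκ : 0 < κ) :
    ∃ L : ℝ≥0, ∀ η : ℝ, 0 < η →
      ∀ᶠ t : ℝ in atTop, t ^ α * P.real (exceptional V Z u L η t) < κ := by
  have hlim : Tendsto (fun c : ℝ => C * c ^ α) (𝓝[>] 0) (𝓝 0) := by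
    have : Tendsto (fun c : ℝ => C * c ^ α) (𝓝 0) (𝓝 (C * 0 ^ α)) :=
      ((Real.continuousAt_rpow_const 0 α (Or.inr hα.le)).tendsto).const_mul C
    rw [Real.zero_rpow hα.ne', mul_zero] at this
    exact this.mono_left nhdsWithin_le_nhds
  obtain ⟨c, hcκ, hc⟩ := ((hlim.eventually (gt_mem_nhds (half_pos hκ))).and
    self_mem_nhdsWithin).exists
  have hc : 0 < c := hc
  lift c to ℝ≥0 using hc.le
  refine ⟨c⁻¹, fun η hη => ?_⟩
  filter_upwards [(hR.negligible η c⁻¹ hη).eventually (gt_mem_nhds (half_pos hκ)),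
    eventually_gt_atTop 0] with t h1 ht
  have h2 := tail_bound_const_mul hα hS c.2 ht
  have hsub : exceptional V Z u c⁻¹ η t ⊆
      {ω | ((∑ k, V ω k : ℝ≥0) : ℝ) ≤ (c⁻¹ : ℝ≥0) * t ∧ ¬ ∃ j, ω ∈ nearRay V Z u η t j} ∪
        {ω | t < (c : ℝ) * ((∑ k, V ω k : ℝ≥0) : ℝ)} := by
    intro ω hω
    by_cases hs : ((∑ k, V ω k : ℝ≥0) : ℝ) ≤ (c⁻¹ : ℝ≥0) * t
    · exact Or.inl ⟨hs, fun h => hω ⟨hs, h⟩⟩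
    · right
      rw [not_le, NNReal.coe_inv, inv_mul_lt_iff₀ hc] at hs
      exact hs
  have h3 := (measureReal_mono hsub (measure_ne_top P _)).trans (measureReal_union_le _ _)
  calc t ^ α * P.real (exceptional V Z u c⁻¹ η t) ≤ t ^ α * (_ + _) :=
        mul_le_mul_of_nonneg_left h3 (Real.rpow_nonneg ht.le α)
    _ = _ := mul_add _ _ _
    _ < κ / 2 + κ / 2 := add_lt_add_of_lt_of_le h1 (h2.trans hcκ.le)
    _ = κ := add_halves κ

/-- Off the exceptional event, `H(V)` is within `ε t` of `H(u_j) Z_j` for one `j`, and the other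
`H(u_i) Z_i` do not exceed `t`. So `{H(V) > t}` is squeezed between almost disjoint unions of the
events `{c H(u_j) Z_j > t}`, with `c < 1` for the lower bound and `c > 1` for the upper, and `c →
1`. -/
theorem RayApproximation.tendsto_tail [Fintype J] [IsProbabilityMeasure P] (hα : 0 < α)
    (hR : RayApproximation P α V Z u) (hV : Measurable V) {C : ℝ}
    (hS : ∀ t : ℝ, 0 < t → t ^ α * P.real {ω | t < ((∑ k, V ω k : ℝ≥0) : ℝ)} ≤ C)
    {H : (Fin d → ℝ≥0) → ℝ≥0} (hh : PosHomogeneous H) (hc : Continuous H) :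
    Tendsto (fun t : ℝ => t ^ α * P.real {ω | t < (H (V ω) : ℝ)}) atTop
      (𝓝 (∑ j, (H (u j) : ℝ) ^ α)) := by
  have hcont : Continuous fun c : ℝ => ∑ j, (c * (H (u j) : ℝ)) ^ α :=
    continuous_finsetSum _ fun j _ =>
      (continuous_id.mul continuous_const).rpow_const fun _ => Or.inr hα.le
  have hlim : Tendsto (fun c : ℝ => ∑ j, (c * (H (u j) : ℝ)) ^ α) (𝓝 1)
      (𝓝 (∑ j, (H (u j) : ℝ) ^ α)) := by
    simpa using hcont.tendsto 1
  have htail : ∀ c : ℝ, 0 < c → Tendsto (fun t : ℝ => ∑ j, t ^ α *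
      P.real {ω | t < c * (H (u j) : ℝ) * (Z j ω : ℝ)}) atTop
      (𝓝 (∑ j, (c * (H (u j) : ℝ)) ^ α)) := by
    intro c hc0
    refine tendsto_finsetSum _ fun j _ => ?_
    simpa using tendsto_tail_const_mul hα (hR.tail j) (c := c * (H (u j) : ℝ)) (by positivity)
  have hnear : ∀ (L : ℝ≥0) (ε : ℝ), 0 < ε → ∃ η : ℝ, 0 < η ∧ ∀ t : ℝ, 0 < t → ∀ ω,
      ω ∉ exceptional V Z u L η t → ∃ j,
        |(H (V ω) : ℝ) - H (u j) * Z j ω| ≤ ε * t ∧ ∀ i, i ≠ j → (H (u i) : ℝ) * Z i ω ≤ t := by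
    intro L ε hε
    obtain ⟨η, hη, hmod⟩ := hh.exists_modulus hc L hε
    have hb : (0 : ℝ) < (∑ j, H (u j) : ℝ≥0) + 1 := by positivity
    -- The second entry forces `H(u_i) Z_i ≤ t` for the indices other than `j`; the `+ 1` keeps the
    -- inverse meaningful when every `H(u_j)` vanishes.
    refine ⟨min η (((∑ j, H (u j) : ℝ≥0) + 1 : ℝ)⁻¹), by positivity, fun t ht ω hω => ?_⟩
    obtain ⟨hs, j, hj1, hj2⟩ := not_not.1 hω
    refine ⟨j, ?_, fun i hi => ?_⟩
    · have h1 := hmod t ht (V ω) (Z j ω • u j) (fun k => ?_) (fun k => ?_)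
      · rw [hh.smul] at h1
        rw [mul_comm (H (u j) : ℝ)]
        exact_mod_cast h1
      · refine le_trans ?_ hs
        exact_mod_cast Finset.single_le_sum (f := V ω) (fun _ _ => zero_le) (Finset.mem_univ k)
      · have := hj1 k
        simp only [Pi.smul_apply, smul_eq_mul, NNReal.coe_mul]
        refine this.trans ?_
        gcongr
        exact min_le_left _ _
    · have h1 := hj2 i hi
      have h2 : (H (u i) : ℝ) ≤ (∑ j, H (u j) : ℝ≥0) + 1 := by
        have : H (u i) ≤ ∑ j, H (u j) :=
          Finset.single_le_sum (f := fun j => H (u j)) (fun _ _ => zero_le) (Finset.mem_univ i)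
        have h3 : (H (u i) : ℝ) ≤ (∑ j, H (u j) : ℝ≥0) := by exact_mod_cast this
        linarith
      calc (H (u i) : ℝ) * Z i ω
          ≤ ((∑ j, H (u j) : ℝ≥0) + 1) * (((∑ j, H (u j) : ℝ≥0) + 1 : ℝ)⁻¹ * t) := by
            gcongr
            refine h1.trans ?_
            gcongr
            exact min_le_right _ _
        _ = t := by field_simp
  refine tendsto_order.2 ⟨fun a ha => ?_, fun a ha => ?_⟩
  · obtain ⟨c, ⟨hca, hc0⟩, hc1⟩ := (((hlim.eventually (lt_mem_nhds ha)).and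
      (lt_mem_nhds (zero_lt_one' ℝ))).filter_mono nhdsWithin_le_nhds |>.and
      (self_mem_nhdsWithin (s := Set.Iio (1 : ℝ)))).exists
    have hc1 : c < 1 := hc1
    have hc1' : 1 < c⁻¹ := (one_lt_inv₀ hc0).2 hc1
    obtain ⟨a', ha1, ha2⟩ := exists_between hca
    -- The exceptional event is subtracted once for each `j`, so its weight is divided by the number
    -- of rays; the `+ 1` covers empty `J`.
    have hκ : 0 < (a' - a) / (Fintype.card J + 1) := by
      have := sub_pos.2 ha1
      positivity
    -- On `E j` one has `H(u_j) Z_j > t / c`, so an error of `(1/c - 1) t` still leaves `H(V) > t`.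
    obtain ⟨L, hL⟩ := hR.eventually_exceptional_lt hα hS hκ
    obtain ⟨η, hη, hev⟩ := hnear L (c⁻¹ - 1) (by linarith)
    filter_upwards [hL η hη, (htail c hc0).eventually (lt_mem_nhds ha2), eventually_gt_atTop 0]
      with t h1 h2 ht
    set E : J → Set Ω := fun j => {ω | t < c * (H (u j) : ℝ) * (Z j ω : ℝ)}
    set G : Set Ω := exceptional V Z u L η t
    have hmG : MeasurableSet G := by
      have h3 : G = ({ω | ((∑ k, V ω k : ℝ≥0) : ℝ) ≤ L * t} ∩ ⋃ j, nearRay V Z u η t j)ᶜ := by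
        ext ω
        simp [G, exceptional]
      rw [h3]
      refine (MeasurableSet.inter ?_ (MeasurableSet.iUnion fun j =>
        measurableSet_nearRay hV hR.measurable η t j)).compl
      refine measurableSet_le ?_ measurable_const
      exact (Finset.measurable_fun_sum _ fun k _ =>
        (measurable_pi_apply k).comp hV).coe_nnreal_real
    have hmE : ∀ j, MeasurableSet (E j) := fun j =>
      measurableSet_lt measurable_const ((hR.measurable j).coe_nnreal_real.const_mul _)
    have hE : ∀ j ω, ω ∈ E j → t < (H (u j) : ℝ) * Z j ω ∧ c⁻¹ * t < (H (u j) : ℝ) * Z j ω := by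
      intro j ω hω
      have hω : t < c * (H (u j) : ℝ) * (Z j ω : ℝ) := hω
      have h5 : c⁻¹ * t < (H (u j) : ℝ) * Z j ω := by
        rw [inv_mul_lt_iff₀ hc0]
        linarith
      refine ⟨lt_trans ?_ h5, h5⟩
      nlinarith
    have hunion : ∑ j, P.real (E j \ G) ≤ P.real {ω | t < (H (V ω) : ℝ)} := by
      rw [← measureReal_iUnion_fintype (fun i j hij => ?_) fun j => (hmE j).diff hmG]
      · refine measureReal_mono (Set.iUnion_subset fun j ω hω => ?_) (measure_ne_top P _)
        obtain ⟨i, hi1, hi2⟩ := hev t ht ω hω.2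
        rcases eq_or_ne j i with rfl | hji
        · have := (hE j ω hω.1).2
          have h6 := (abs_le.1 hi1).1
          show t < (H (V ω) : ℝ)
          linarith
        · exact absurd (hE j ω hω.1).1 (not_lt.2 (hi2 j hji))
      -- Off `G` only one index can have `H(u_l) Z_l > t`, so the sets `E j \ G` are disjoint.
      · rw [Function.onFun, Set.disjoint_left]
        rintro ω hω1 hω2
        obtain ⟨k, -, hk⟩ := hev t ht ω hω1.2
        have h7 : ∀ l, ω ∈ E l → l = k := fun l hl => by
          by_contra hlk
          exact absurd (hE l ω hl).1 (not_lt.2 (hk l hlk))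
        exact hij ((h7 i hω1.1).trans (h7 j hω2.1).symm)
    have hsplit : ∀ j, P.real (E j) ≤ P.real (E j \ G) + P.real G := fun j =>
      (measureReal_mono (fun ω hω => by by_cases h : ω ∈ G <;> simp [h, hω])
        (measure_ne_top P _)).trans (measureReal_union_le _ _)
    have htα : 0 < t ^ α := Real.rpow_pos_of_pos ht α
    have h8 : ∑ j, t ^ α * P.real (E j) ≤ t ^ α * P.real {ω | t < (H (V ω) : ℝ)} +
        Fintype.card J * (t ^ α * P.real G) := by
      calc ∑ j, t ^ α * P.real (E j)
          ≤ ∑ j, t ^ α * (P.real (E j \ G) + P.real G) := by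
            gcongr with j
            exact hsplit j
        _ = t ^ α * ∑ j, P.real (E j \ G) + Fintype.card J * (t ^ α * P.real G) := by
            rw [← Finset.mul_sum, Finset.sum_add_distrib, mul_add]
            simp
            ring
        _ ≤ _ := by gcongr
    have h9 : (Fintype.card J : ℝ) * (t ^ α * P.real G) ≤ a' - a := by
      have h10 : 0 ≤ t ^ α * P.real G := by positivity
      rw [lt_div_iff₀ (by positivity)] at h1
      nlinarith
    linarith
  · obtain ⟨c, hca, hc1⟩ := (((hlim.eventually (gt_mem_nhds ha))).filter_mono
      nhdsWithin_le_nhds |>.and (self_mem_nhdsWithin (s := Set.Ioi (1 : ℝ)))).exists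
    have hc1 : 1 < c := hc1
    have hc0 : 0 < c := one_pos.trans hc1
    have hc1' : c⁻¹ < 1 := inv_lt_one_of_one_lt₀ hc1
    obtain ⟨a', ha1, ha2⟩ := exists_between hca
    obtain ⟨L, hL⟩ := hR.eventually_exceptional_lt hα hS (sub_pos.2 ha2)
    -- If `H(V) > t`, an error of `(1 - 1/c) t` leaves `H(u_j) Z_j > t / c`.
    obtain ⟨η, hη, hev⟩ := hnear L (1 - c⁻¹) (by linarith)
    filter_upwards [hL η hη, (htail c hc0).eventually (gt_mem_nhds ha1), eventually_gt_atTop 0]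
      with t h1 h2 ht
    have hsub : {ω | t < (H (V ω) : ℝ)} ⊆ (⋃ j, {ω | t < c * (H (u j) : ℝ) * (Z j ω : ℝ)}) ∪
        exceptional V Z u L η t := by
      intro ω hω
      have hω : t < (H (V ω) : ℝ) := hω
      by_cases hG : ω ∈ exceptional V Z u L η t
      · exact Or.inr hG
      · left
        obtain ⟨j, hj, -⟩ := hev t ht ω hG
        refine Set.mem_iUnion.2 ⟨j, ?_⟩
        have h3 := (abs_le.1 hj).2
        show t < c * (H (u j) : ℝ) * (Z j ω : ℝ)
        have h4 : c⁻¹ * t < (H (u j) : ℝ) * Z j ω := by linarith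
        rw [inv_mul_lt_iff₀ hc0] at h4
        linarith
    have htα : 0 < t ^ α := Real.rpow_pos_of_pos ht α
    have h3 := (measureReal_mono hsub (measure_ne_top P _)).trans (measureReal_union_le _ _)
    have h4 := measureReal_iUnion_fintype_le (μ := P)
      fun j => {ω | t < c * (H (u j) : ℝ) * (Z j ω : ℝ)}
    rw [← Finset.mul_sum] at h2
    calc t ^ α * P.real {ω | t < (H (V ω) : ℝ)}
        ≤ t ^ α * (∑ j, P.real {ω | t < c * (H (u j) : ℝ) * (Z j ω : ℝ)} +
            P.real (exceptional V Z u L η t)) := by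
          gcongr
          linarith
      _ < a := by
          rw [mul_add]
          linarith

end Rays

/-! ### Ray approximation from regular variation -/

section RegularVariation

/-- The coordinates of a point of `[0,∞]^d`, truncated at the levels `L`. -/
def truncate {d : ℕ} (L : Fin d → ℝ≥0) (x : Fin d → ℝ≥0∞) : Fin d → ℝ :=
  fun i => (min (x i) (L i)).toReal

theorem continuous_truncate {d : ℕ} (L : Fin d → ℝ≥0) : Continuous (truncate L) := by
  refine continuous_pi fun i => ?_
  refine ENNReal.continuousOn_toReal.comp_continuous
    ((continuous_apply i).min continuous_const) fun x => ?_
  exact ne_top_of_le_ne_top ENNReal.coe_ne_top (min_le_right _ _)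

theorem truncate_div {d : ℕ} (L v : Fin d → ℝ≥0) {t : ℝ} (ht : 0 < t) (i : Fin d) :
    truncate L (fun j => (v j : ℝ≥0∞) / ENNReal.ofReal t) i = min ((v i : ℝ) / t) (L i) := by
  lift t to ℝ≥0 using ht.le
  have ht' : t ≠ 0 := by
    rintro rfl
    simp at ht
  rw [truncate, ENNReal.ofReal_coe_nnreal, ← ENNReal.coe_div ht', ← ENNReal.coe_min,
    ENNReal.coe_toReal, NNReal.coe_min, NNReal.coe_div]

theorem truncate_nonneg {d : ℕ} (L : Fin d → ℝ≥0) (x : Fin d → ℝ≥0∞) (i : Fin d) :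
    0 ≤ truncate L x i := ENNReal.toReal_nonneg

/-- Compactness at infinity is free in `[0,∞]^d`, so being bounded away from `0` is all that the
support of a test function needs. -/
theorem isCompact_setOf_exists_le {d : ℕ} {r : ℝ≥0∞} (hr : 0 < r) :
    IsCompact {x : PuncturedOrthant d | ∃ i, r ≤ x.1 i} := by
  rw [Subtype.isCompact_iff]
  have h1 : (Subtype.val '' {x : PuncturedOrthant d | ∃ i, r ≤ x.1 i}) =
      ⋃ i, {x : Fin d → ℝ≥0∞ | r ≤ x i} := by
    ext x
    simp only [Set.mem_image, Set.mem_iUnion]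
    constructor
    · rintro ⟨y, hy, rfl⟩
      exact hy
    · rintro ⟨i, hi⟩
      refine ⟨⟨x, ?_⟩, ⟨i, hi⟩, rfl⟩
      rintro rfl
      exact absurd hi (not_le.2 hr)
  rw [h1]
  exact (isClosed_iUnion_of_finite fun i =>
    isClosed_le continuous_const (continuous_apply i)).isCompact

variable {Ω : Type*} [MeasurableSpace Ω] {P : Measure Ω} [IsProbabilityMeasure P]
  {α : ℝ} {d : ℕ} {V : Ω → Fin d → ℝ≥0} {N : Seminorm ℝ (Fin d → ℝ)}
  {μ : Measure (PuncturedOrthant d)} {l : Fin d → ℝ}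

omit [IsProbabilityMeasure P] in
-- For `d = 0` the punctured orthant is empty and carries no nonzero measure.
theorem IsRegularlyVarying.nonempty (hRV : IsRegularlyVarying P N V μ) : Nonempty (Fin d) := by
  by_contra hcon
  rw [not_nonempty_iff] at hcon
  have : IsEmpty (PuncturedOrthant d) := ⟨fun x => x.2 (Subsingleton.elim _ _)⟩
  exact hRV.ne_zero (Measure.eq_zero_of_isEmpty μ)

/-- Equivalence of norms gives `V_j ≤ C · N V`. Positivity of the normalizing probability allows it
to be cancelled in the vague limit. -/
theorem eventually_norm_tail_pos (hα : 0 < α)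
    (hl : ∀ j, 0 < l j)
    (htail : ∀ j, Tendsto (fun t : ℝ => t ^ α * P.real {ω | t < (V ω j : ℝ)}) atTop (𝓝 (l j)))
    (hN : ∀ x, N x = 0 → x = 0) [Nonempty (Fin d)] :
    ∀ᶠ t : ℝ in atTop, 0 < P.real {ω | t < N (fun j => (V ω j : ℝ))} := by
  obtain ⟨j⟩ := ‹Nonempty (Fin d)›
  obtain ⟨C, hC, hb⟩ := exists_abs_le_mul_of_definite N hN (LinearMap.proj j)
  have h1 := tendsto_tail_const_mul hα (htail j) (inv_nonneg.2 hC.le)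
  have h2 : 0 < C⁻¹ ^ α * l j := mul_pos (Real.rpow_pos_of_pos (inv_pos.2 hC) α) (hl j)
  filter_upwards [h1.eventually (lt_mem_nhds h2), eventually_gt_atTop 0] with t h3 ht
  have h4 : 0 < P.real {ω | t < C⁻¹ * (V ω j : ℝ)} :=
    pos_of_mul_pos_right h3 (Real.rpow_nonneg ht.le α)
  refine h4.trans_le (measureReal_mono (fun ω hω => ?_) (measure_ne_top P _))
  have hω : t < C⁻¹ * (V ω j : ℝ) := hω
  refine hω.trans_le ?_
  rw [inv_mul_le_iff₀ hC]
  exact (le_abs_self _).trans (hb fun j => (V ω j : ℝ))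

theorem exists_norm_tail_bound (hα : 0 < α)
    (htail : ∀ j, Tendsto (fun t : ℝ => t ^ α * P.real {ω | t < (V ω j : ℝ)}) atTop (𝓝 (l j))) :
    ∃ C : ℝ, ∀ t : ℝ, 0 < t →
      t ^ α * P.real {ω | t < N (fun j => (V ω j : ℝ))} ≤ C := by
  obtain ⟨C, -, hC⟩ := exists_sum_tail_bound hα htail
  obtain ⟨B, hB, hb⟩ := exists_le_mul_sum_abs N
  refine ⟨C * B ^ α, fun t ht => ?_⟩
  refine le_trans ?_ (tail_bound_const_mul hα hC hB.le ht)
  have := Real.rpow_nonneg ht.le α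
  refine mul_le_mul_of_nonneg_left
    (measureReal_mono (fun ω (hω : t < N (fun j => (V ω j : ℝ))) => ?_) (measure_ne_top P _)) this
  refine hω.trans_le ((hb _).trans (le_of_eq ?_))
  push_cast
  simp

/-- The truncated `Φ` is a compactly supported test function, as it vanishes near `0`, and its
`μ`-integral is zero. Vague convergence and Markov's inequality make the probability `o(P(N V >
t))`, and `P(N V > t) = O(t^{-α})`. -/
theorem IsRegularlyVarying.tendsto_tail_zero (hα : 0 < α) (hV : Measurable V) (hl : ∀ j, 0 < l j)
    (htail : ∀ j, Tendsto (fun t : ℝ => t ^ α * P.real {ω | t < (V ω j : ℝ)}) atTop (𝓝 (l j)))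
    (hN : ∀ x, N x = 0 → x = 0) (hRV : IsRegularlyVarying P N V μ)
    (L : Fin d → ℝ≥0) {Φ : (Fin d → ℝ) → ℝ} (hΦ : Continuous Φ) (hΦ0 : ∀ y, 0 ≤ Φ y)
    {r : ℝ} (hr : 0 < r) (hsmall : ∀ y : Fin d → ℝ, (∀ i, 0 ≤ y i ∧ y i ≤ r) → Φ y = 0)
    (hnull : ∀ᵐ x ∂μ, Φ (truncate L x.1) = 0) {c : ℝ} (hc : 0 < c) :
    Tendsto (fun t : ℝ => t ^ α * P.real {ω | c ≤ Φ fun i => min ((V ω i : ℝ) / t) (L i)})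
      atTop (𝓝 0) := by
  have := hRV.nonempty
  have hΨ : Continuous fun x : Fin d → ℝ≥0∞ => Φ (truncate L x) :=
    hΦ.comp (continuous_truncate L)
  let f : C_c(PuncturedOrthant d, ℝ) :=
    ⟨⟨fun x => Φ (truncate L x.1), hΨ.comp continuous_subtype_val⟩, by
      refine HasCompactSupport.intro
        (isCompact_setOf_exists_le (d := d) (r := ENNReal.ofReal r) (by simpa using hr))
        fun x hx => ?_
      simp only [Set.mem_ofPred_eq, not_exists, not_le] at hx
      refine hsmall _ fun i => ⟨truncate_nonneg _ _ _, ?_⟩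
      exact ENNReal.toReal_le_of_le_ofReal hr.le ((min_le_left _ _).trans (hx i).le)⟩
  have hf0 : ∫ x, f x ∂μ = 0 := integral_eq_zero_of_ae hnull
  have hzero : Φ (truncate L 0) = 0 := by
    refine hsmall _ fun i => ?_
    simp [truncate, hr.le]
  have hint : ∀ t : ℝ, 0 < t → ∫ x, f x ∂(scaledLaw P V t) =
      ∫ ω, Φ (fun i => min ((V ω i : ℝ) / t) (L i)) ∂P := by
    intro t ht
    have hm : Measurable fun ω j => (V ω j : ℝ≥0∞) / ENNReal.ofReal t :=
      measurable_pi_lambda _ fun j =>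
        ((measurable_pi_apply j).comp hV).coe_nnreal_ennreal.div_const _
    have hms : MeasurableSet {x : Fin d → ℝ≥0∞ | x ≠ 0} := (measurableSet_singleton 0).compl
    have h1 := integral_subtype_comap
      (μ := P.map fun ω j => (V ω j : ℝ≥0∞) / ENNReal.ofReal t) hms
      (fun x => Φ (truncate L x))
    calc ∫ x, f x ∂(scaledLaw P V t)
        = ∫ x in {x : Fin d → ℝ≥0∞ | x ≠ 0}, Φ (truncate L x)
            ∂(P.map fun ω j => (V ω j : ℝ≥0∞) / ENNReal.ofReal t) := h1
      -- The scaled law drops the mass of `{V = 0}`; the integrand vanishes at the origin.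
      _ = ∫ x, Φ (truncate L x) ∂(P.map fun ω j => (V ω j : ℝ≥0∞) / ENNReal.ofReal t) := by
          refine setIntegral_eq_integral_of_forall_compl_eq_zero fun x hx => ?_
          have : x = 0 := not_not.1 hx
          rw [this, hzero]
      _ = ∫ ω, Φ (truncate L fun j => (V ω j : ℝ≥0∞) / ENNReal.ofReal t) ∂P :=
          integral_map hm.aemeasurable hΨ.aestronglyMeasurable
      _ = _ := by
          congr 1
          ext ω
          congr 1
          ext i
          exact truncate_div L (V ω) ht i
  have hmarkov : ∀ t : ℝ, 0 < t →
      P.real {ω | c ≤ Φ fun i => min ((V ω i : ℝ) / t) (L i)} ≤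
        c⁻¹ * ∫ x, f x ∂(scaledLaw P V t) := by
    intro t ht
    rw [hint t ht, ← div_eq_inv_mul, le_div_iff₀ hc, mul_comm]
    refine mul_meas_ge_le_integral_of_nonneg (ae_of_all _ fun ω => hΦ0 _) ?_ c
    obtain ⟨B, hB⟩ := (isCompact_univ (X := Fin d → ℝ≥0∞)).bddAbove_image hΨ.continuousOn
    refine Integrable.of_bound (C := B) ?_ (ae_of_all _ fun ω => ?_)
    · refine (hΦ.measurable.comp (measurable_pi_lambda _ fun i => ?_)).aestronglyMeasurable
      exact ((((measurable_pi_apply i).comp hV).coe_nnreal_real).div_const t).min measurable_const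
    · rw [Real.norm_of_nonneg (hΦ0 _)]
      refine hB ⟨fun j => (V ω j : ℝ≥0∞) / ENNReal.ofReal t, Set.mem_univ _, ?_⟩
      show Φ _ = Φ _
      congr 1
      ext i
      exact truncate_div L (V ω) ht i
  obtain ⟨C, hC⟩ := exists_norm_tail_bound (N := N) hα htail
  have hlim := ((hRV.vague f).const_mul c⁻¹).mul_const C
  rw [hf0, mul_zero, zero_mul] at hlim
  refine squeeze_zero' ?_ ?_ hlim
  · filter_upwards [eventually_gt_atTop 0] with t ht
    have := Real.rpow_nonneg ht.le α
    positivity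
  · filter_upwards [eventually_gt_atTop 0, eventually_norm_tail_pos hα hl htail hN] with t ht hp
    set p := P.real {ω | t < N (fun j => (V ω j : ℝ))}
    have htα : 0 < t ^ α := Real.rpow_pos_of_pos ht α
    have hI : 0 ≤ ∫ x, f x ∂(scaledLaw P V t) := integral_nonneg fun x => hΦ0 _
    calc t ^ α * P.real {ω | c ≤ Φ fun i => min ((V ω i : ℝ) / t) (L i)}
        ≤ t ^ α * (c⁻¹ * ∫ x, f x ∂(scaledLaw P V t)) := by
          gcongr
          exact hmarkov t ht
      _ = c⁻¹ * ((∫ x, f x ∂(scaledLaw P V t)) / p) * (t ^ α * p) := by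
          field_simp
      _ ≤ _ := by
          gcongr
          exact hC t ht

/-- The test function `(min(y_i, y_j) - η/2)⁺`, truncated at `η`, vanishes on the axes and near `0`,
and equals `η/2` once both coordinates exceed `η`. -/
theorem tendsto_joint_tail_of_asymptoticallyIndependent (hα : 0 < α) (hV : Measurable V)
    (hl : ∀ j, 0 < l j)
    (htail : ∀ j, Tendsto (fun t : ℝ => t ^ α * P.real {ω | t < (V ω j : ℝ)}) atTop (𝓝 (l j)))
    (hN : ∀ x, N x = 0 → x = 0) (hRV : IsRegularlyVarying P N V μ)
    (hμ : AsymptoticallyIndependent μ) {i j : Fin d} (hij : i ≠ j) {η : ℝ} (hη : 0 < η) :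
    Tendsto (fun t : ℝ => t ^ α * P.real {ω | η * t < V ω i ∧ η * t < V ω j}) atTop (𝓝 0) := by
  lift η to ℝ≥0 using hη.le
  have key := hRV.tendsto_tail_zero hα hV hl htail hN (fun _ => η)
    (Φ := fun y => max (min (y i) (y j) - η / 2) 0) (r := (η : ℝ) / 2) (c := (η : ℝ) / 2)
    (by fun_prop) (fun _ => le_max_right _ _) (half_pos hη) (fun y hy => ?_) ?_ (half_pos hη)
  · refine squeeze_zero' ?_ ?_ key
    · filter_upwards [eventually_gt_atTop 0] with t ht
      have := Real.rpow_nonneg ht.le α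
      positivity
    · filter_upwards [eventually_gt_atTop 0] with t ht
      refine mul_le_mul_of_nonneg_left (measureReal_mono (fun ω hω => ?_) (measure_ne_top P _))
        (Real.rpow_nonneg ht.le α)
      obtain ⟨h1, h2⟩ := hω
      rw [← lt_div_iff₀ ht] at h1 h2
      show (η : ℝ) / 2 ≤ max (min (min ((V ω i : ℝ) / t) η) (min ((V ω j : ℝ) / t) η) - η / 2) 0
      rw [min_eq_right h1.le, min_eq_right h2.le, min_self]
      exact le_max_of_le_left (by linarith)
  · refine max_eq_right ?_
    have := min_le_left (y i) (y j)
    have := (hy i).2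
    linarith
  · filter_upwards [hμ] with x hx
    obtain ⟨k, hk⟩ := hx
    refine max_eq_right ?_
    have hz : ∀ m, m ≠ k → truncate (fun _ => η) x.1 m = 0 := fun m hm => by
      rw [truncate, hk m hm]
      simp
    rcases eq_or_ne i k with rfl | hik
    · have := min_le_right (truncate (fun _ => η) x.1 i) (truncate (fun _ => η) x.1 j)
      rw [hz j hij.symm] at this
      rw [hz j hij.symm]
      linarith
    · have := min_le_left (truncate (fun _ => η) x.1 i) (truncate (fun _ => η) x.1 j)
      rw [hz i hik] at this
      rw [hz i hik]
      linarith

/-- The test function `(|y_i/k_i - y_j/k_j| - η/2)⁺` vanishes on the ray spanned by `k = K^{1/α}`.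
Truncation levels proportional to `k` keep truncated ray points on the ray. The restriction `∑ V_m ≤
L t` keeps the truncation from altering coordinates `i` and `j`. -/
theorem tendsto_gap_tail_of_asymptoticallyFullyDependent (hα : 0 < α) (hV : Measurable V)
    (hl : ∀ j, 0 < l j)
    (htail : ∀ j, Tendsto (fun t : ℝ => t ^ α * P.real {ω | t < (V ω j : ℝ)}) atTop (𝓝 (l j)))
    (hN : ∀ x, N x = 0 → x = 0) (hRV : IsRegularlyVarying P N V μ)
    {K : Fin d → ℝ≥0} (hK : ∀ j, 0 < K j)
    (hμ : AsymptoticallyFullyDependent K α μ) (i j : Fin d) (L : ℝ≥0) {η : ℝ} (hη : 0 < η) :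
    Tendsto (fun t : ℝ => t ^ α * P.real {ω | ((∑ m, V ω m : ℝ≥0) : ℝ) ≤ L * t ∧
      η * t < |(V ω i : ℝ) / (K i ^ (1 / α) : ℝ≥0) - (V ω j : ℝ) / (K j ^ (1 / α) : ℝ≥0)|})
      atTop (𝓝 0) := by
  set k : Fin d → ℝ≥0 := fun j => K j ^ (1 / α) with hk
  have hkpos : ∀ j, 0 < k j := fun j => NNReal.rpow_pos (hK j)
  have hkpos' : ∀ j, (0 : ℝ) < k j := fun j => by exact_mod_cast hkpos j
  -- Large enough that the levels `M k_i` and `M k_j` are both at least `L`.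
  set M : ℝ≥0 := L / k i + L / k j with hM
  have hMi : ∀ m, (m = i ∨ m = j) → L ≤ M * k m := by
    rintro m (rfl | rfl)
    · calc L = L / k m * k m := (div_mul_cancel₀ L (hkpos m).ne').symm
        _ ≤ M * k m := by gcongr; exact le_self_add
    · calc L = L / k m * k m := (div_mul_cancel₀ L (hkpos m).ne').symm
        _ ≤ M * k m := by gcongr; exact le_add_self
  have key := hRV.tendsto_tail_zero hα hV hl htail hN (fun m => M * k m)
    (Φ := fun y => max (|y i / k i - y j / k j| - η / 2) 0)
    (r := η / 2 * min (k i : ℝ) (k j)) (c := η / 2)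
    (by fun_prop) (fun _ => le_max_right _ _)
    (mul_pos (half_pos hη) (lt_min (hkpos' i) (hkpos' j))) (fun y hy => ?_) ?_ (half_pos hη)
  · refine squeeze_zero' ?_ ?_ key
    · filter_upwards [eventually_gt_atTop 0] with t ht
      have := Real.rpow_nonneg ht.le α
      positivity
    · filter_upwards [eventually_gt_atTop 0] with t ht
      refine mul_le_mul_of_nonneg_left (measureReal_mono (fun ω hω => ?_) (measure_ne_top P _))
        (Real.rpow_nonneg ht.le α)
      obtain ⟨h1, h2⟩ := hω
      have h3 : ∀ m, (m = i ∨ m = j) → (V ω m : ℝ) / t ≤ (M * k m : ℝ≥0) := by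
        intro m hm
        rw [div_le_iff₀ ht]
        have h4 : V ω m ≤ ∑ m, V ω m :=
          Finset.single_le_sum (f := V ω) (fun _ _ => zero_le) (Finset.mem_univ m)
        have h5 : (V ω m : ℝ) ≤ (∑ m, V ω m : ℝ≥0) := by exact_mod_cast h4
        refine h5.trans (h1.trans ?_)
        gcongr
        exact_mod_cast hMi m hm
      show η / 2 ≤ max (|min ((V ω i : ℝ) / t) (M * k i : ℝ≥0) / k i -
        min ((V ω j : ℝ) / t) (M * k j : ℝ≥0) / k j| - η / 2) 0
      rw [min_eq_left (h3 i (Or.inl rfl)), min_eq_left (h3 j (Or.inr rfl))]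
      refine le_max_of_le_left ?_
      have h6 : (V ω i : ℝ) / t / k i - (V ω j : ℝ) / t / k j =
          ((V ω i : ℝ) / k i - (V ω j : ℝ) / k j) / t := by
        rw [sub_div, div_right_comm, div_right_comm (V ω j : ℝ)]
      rw [h6, abs_div, abs_of_pos ht]
      rw [← lt_div_iff₀ ht] at h2
      linarith
  · refine max_eq_right ?_
    have hb : ∀ m, (m = i ∨ m = j) → 0 ≤ y m / k m ∧ y m / k m ≤ η / 2 := by
      intro m hm
      refine ⟨div_nonneg (hy m).1 (hkpos' m).le, ?_⟩
      rw [div_le_iff₀ (hkpos' m)]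
      refine (hy m).2.trans ?_
      gcongr
      rcases hm with rfl | rfl
      · exact min_le_left _ _
      · exact min_le_right _ _
    have h1 := hb i (Or.inl rfl)
    have h2 := hb j (Or.inr rfl)
    rw [sub_nonpos, abs_le]
    constructor <;> linarith
  · filter_upwards [hμ] with x hx
    obtain ⟨s, -, hs⟩ := hx
    have hz : ∀ m, truncate (fun m => M * k m) x.1 m / k m = min s M := fun m => by
      rw [truncate, hs m, ← ENNReal.coe_min, ENNReal.coe_toReal, ← min_mul, NNReal.coe_mul]
      exact mul_div_cancel_right₀ _ (hkpos' m).ne'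
    rw [hz i, hz j, sub_self, abs_zero]
    exact max_eq_right (by linarith)

omit [IsProbabilityMeasure P] in
theorem tendsto_tail_div_root (hα : 0 < α) {X : Ω → ℝ≥0} {K : ℝ≥0} (hK : 0 < K)
    (hX : Tendsto (fun t : ℝ => t ^ α * P.real {ω | t < (X ω : ℝ)}) atTop (𝓝 K)) :
    Tendsto (fun t : ℝ => t ^ α * P.real {ω | t < ((X ω / K ^ (1 / α) : ℝ≥0) : ℝ)}) atTop
      (𝓝 1) := by
  have hk : (0 : ℝ) < (K ^ (1 / α) : ℝ≥0) := by exact_mod_cast NNReal.rpow_pos hK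
  have h1 := tendsto_tail_const_mul hα hX (inv_nonneg.2 hk.le)
  have h2 : (((K ^ (1 / α) : ℝ≥0) : ℝ)⁻¹) ^ α * K = 1 := by
    rw [Real.inv_rpow hk.le, NNReal.coe_rpow, ← Real.rpow_mul K.coe_nonneg, one_div_mul_cancel hα.ne',
      Real.rpow_one]
    exact inv_mul_cancel₀ (by exact_mod_cast hK.ne')
  rw [h2] at h1
  refine h1.congr fun t => ?_
  simp_rw [NNReal.coe_div, div_eq_inv_mul ((X _ : ℝ≥0) : ℝ)]

/-- Under asymptotic independence the extremes of `V` are those of its coordinate vectors. -/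
theorem IsRegularlyVarying.rayApproximation_of_asymptoticallyIndependent (hα : 0 < α)
    (hV : Measurable V) {K : Fin d → ℝ≥0} (hK : ∀ j, 0 < K j)
    (htail : ∀ j, Tendsto (fun t : ℝ => t ^ α * P.real {ω | t < (V ω j : ℝ)}) atTop (𝓝 (K j)))
    (hN : ∀ x, N x = 0 → x = 0) (hRV : IsRegularlyVarying P N V μ)
    (hμ : AsymptoticallyIndependent μ) :
    RayApproximation P α V (fun j ω => V ω j / K j ^ (1 / α))
      (fun j => Pi.single j (K j ^ (1 / α))) := by
  have := hRV.nonempty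
  set k : Fin d → ℝ≥0 := fun j => K j ^ (1 / α) with hk
  have hkpos : ∀ j, 0 < k j := fun j => NNReal.rpow_pos (hK j)
  have hkpos' : ∀ j, (0 : ℝ) < k j := fun j => by exact_mod_cast hkpos j
  refine ⟨fun j => ((measurable_pi_apply j).comp hV).div_const _, fun j => ?_, fun η L hη => ?_⟩
  · exact tendsto_tail_div_root hα (hK j) (htail j)
  -- The bound `m ≤ 1` turns `V_i ≤ η m t` into closeness to an axis, and `m ≤ k_i` turns it into
  -- `Z_i ≤ η t`; hence failure of the approximation forces two coordinates above `η m t`.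
  · set m : ℝ := (1 + ∑ j, (k j : ℝ)⁻¹)⁻¹ with hm
    have hsum : (0 : ℝ) ≤ ∑ j, (k j : ℝ)⁻¹ := Finset.sum_nonneg fun j _ => by positivity
    have hm0 : 0 < m := by positivity
    have hm1 : m ≤ 1 := inv_le_one_of_one_le₀ (by linarith)
    have hmk : ∀ j, m ≤ k j := by
      intro j
      rw [hm]
      refine inv_le_of_inv_le₀ (hkpos' j) ?_
      have := Finset.single_le_sum (f := fun j => (k j : ℝ)⁻¹) (fun _ _ => by positivity)
        (Finset.mem_univ j)
      linarith
    have hpair : Tendsto (fun t : ℝ => ∑ p ∈ (Finset.univ : Finset (Fin d)).offDiag, t ^ α *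
        P.real {ω | η * m * t < V ω p.1 ∧ η * m * t < V ω p.2}) atTop (𝓝 0) := by
      rw [← Finset.sum_const_zero (s := (Finset.univ : Finset (Fin d)).offDiag)]
      refine tendsto_finsetSum _ fun p hp => ?_
      exact tendsto_joint_tail_of_asymptoticallyIndependent hα hV
        (fun j => by exact_mod_cast hK j) htail hN hRV hμ (Finset.mem_offDiag.1 hp).2.2
        (mul_pos hη hm0)
    refine squeeze_zero' ?_ ?_ hpair
    · filter_upwards [eventually_gt_atTop 0] with t ht
      have := Real.rpow_nonneg ht.le α
      positivity
    · filter_upwards [eventually_gt_atTop 0] with t ht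
      rw [← Finset.mul_sum]
      refine mul_le_mul_of_nonneg_left ?_ (Real.rpow_nonneg ht.le α)
      refine le_trans (measureReal_mono (fun ω hω => ?_) (measure_ne_top P _))
        (measureReal_biUnion_finset_le _ _)
      by_contra hcon
      simp only [Set.mem_iUnion, Finset.mem_offDiag, Finset.mem_univ, true_and, not_exists,
        Set.mem_ofPred_eq, not_and, not_lt] at hcon
      obtain ⟨j, hj⟩ : ∃ j, ∀ i, i ≠ j → (V ω i : ℝ) ≤ η * m * t := by
        by_cases h : ∃ j, η * m * t < V ω j
        · obtain ⟨j, hj⟩ := h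
          exact ⟨j, fun i hi => hcon (j, i) hi.symm hj⟩
        · push Not at h
          -- If no coordinate is large, any axis serves.
          exact ⟨Classical.arbitrary _, fun i _ => h i⟩
      have hηt : 0 < η * t := mul_pos hη ht
      refine hω.2 ⟨j, fun i => ?_, fun i hi => ?_⟩
      · rcases eq_or_ne i j with rfl | hij
        · beta_reduce
          rw [Pi.single_eq_same, NNReal.coe_div, div_mul_cancel₀ _ (hkpos' i).ne', sub_self,
            abs_zero]
          exact hηt.le
        · beta_reduce
          rw [Pi.single_eq_of_ne hij, NNReal.coe_zero, mul_zero, sub_zero,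
            abs_of_nonneg (V ω i).coe_nonneg]
          refine (hj i hij).trans ?_
          nlinarith
      · rw [NNReal.coe_div, div_le_iff₀ (hkpos' i)]
        refine (hj i hi).trans ?_
        have := hmk i
        nlinarith

/-- Under asymptotic full dependence the extremes of `V` are those of a multiple of
`K^{1/α} 1`. -/
theorem IsRegularlyVarying.rayApproximation_of_asymptoticallyFullyDependent (hα : 0 < α)
    (hV : Measurable V) {K : Fin d → ℝ≥0} (hK : ∀ j, 0 < K j)
    (htail : ∀ j, Tendsto (fun t : ℝ => t ^ α * P.real {ω | t < (V ω j : ℝ)}) atTop (𝓝 (K j)))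
    (hN : ∀ x, N x = 0 → x = 0) (hRV : IsRegularlyVarying P N V μ)
    (hμ : AsymptoticallyFullyDependent K α μ) (j : Fin d) :
    RayApproximation P α V (fun (_ : Unit) ω => V ω j / K j ^ (1 / α))
      (fun _ i => K i ^ (1 / α)) := by
  set k : Fin d → ℝ≥0 := fun j => K j ^ (1 / α) with hk
  have hkpos : ∀ j, 0 < k j := fun j => NNReal.rpow_pos (hK j)
  have hkpos' : ∀ j, (0 : ℝ) < k j := fun j => by exact_mod_cast hkpos j
  refine ⟨fun _ => ((measurable_pi_apply j).comp hV).div_const _, fun _ => ?_, fun η L hη => ?_⟩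
  · exact tendsto_tail_div_root hα (hK j) (htail j)
  -- The threshold `η / k_i` becomes `η` after multiplying the gap by `k_i`, giving `|V_i - Z k_i| ≤
  -- η t`.
  · have hgap : Tendsto (fun t : ℝ => ∑ i, t ^ α * P.real
        {ω | ((∑ m, V ω m : ℝ≥0) : ℝ) ≤ L * t ∧
          η / k i * t < |(V ω i : ℝ) / k i - (V ω j : ℝ) / k j|}) atTop (𝓝 0) := by
      rw [← Finset.sum_const_zero (s := (Finset.univ : Finset (Fin d)))]
      refine tendsto_finsetSum _ fun i _ => ?_
      exact tendsto_gap_tail_of_asymptoticallyFullyDependent hα hV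
        (fun j => by exact_mod_cast hK j) htail hN hRV hK hμ i j L (div_pos hη (hkpos' i))
    refine squeeze_zero' ?_ ?_ hgap
    · filter_upwards [eventually_gt_atTop 0] with t ht
      have := Real.rpow_nonneg ht.le α
      positivity
    · filter_upwards [eventually_gt_atTop 0] with t ht
      rw [← Finset.mul_sum]
      refine mul_le_mul_of_nonneg_left ?_ (Real.rpow_nonneg ht.le α)
      refine le_trans (measureReal_mono (fun ω hω => ?_) (measure_ne_top P _))
        (measureReal_iUnion_fintype_le _)
      by_contra hcon
      simp only [Set.mem_iUnion, not_exists, Set.mem_ofPred_eq, not_and, not_lt] at hcon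
      refine hω.2 ⟨(), fun i => ?_, fun i hi => absurd rfl hi⟩
      have h1 := hcon i hω.1
      rw [div_mul_eq_mul_div, le_div_iff₀ (hkpos' i)] at h1
      refine le_trans (le_of_eq ?_) h1
      rw [← abs_of_pos (hkpos' i), ← abs_mul, abs_of_pos (hkpos' i), sub_mul,
        div_mul_cancel₀ _ (hkpos' i).ne', NNReal.coe_div]

end RegularVariation

/-! ### Conditioning on an independent variable -/

section Independence

variable {Ω β γ : Type*} [MeasurableSpace Ω] [MeasurableSpace β] [MeasurableSpace γ]
  {P : Measure Ω} [IsProbabilityMeasure P] {X : Ω → β} {Y : Ω → γ} {E : Set (β × γ)}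

omit [IsProbabilityMeasure P] in
theorem measurable_measureReal_section [SFinite P] (hX : Measurable X) (hY : Measurable Y)
    (hE : MeasurableSet E) : Measurable fun ω => P.real {ω' | (X ω, Y ω') ∈ E} := by
  have h1 : Measurable fun x => (P.map Y) (Prod.mk x ⁻¹' E) := measurable_measure_prodMk_left hE
  convert (h1.comp hX).ennreal_toReal using 2 with ω
  rw [Function.comp, Measure.map_apply hY (measurable_prodMk_left hE)]
  rfl

/-- Tonelli for the product law: `X` is frozen at `ω` and `Y` is resampled at `ω'`. -/
theorem measureReal_eq_integral_of_indepFun (hX : Measurable X) (hY : Measurable Y)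
    (hXY : IndepFun X Y P) (hE : MeasurableSet E) :
    P.real {ω | (X ω, Y ω) ∈ E} = ∫ ω, P.real {ω' | (X ω, Y ω') ∈ E} ∂P := by
  have h1 : Measurable fun x => (P.map Y) (Prod.mk x ⁻¹' E) := measurable_measure_prodMk_left hE
  have := Measure.isProbabilityMeasure_map (μ := P) hY.aemeasurable
  have h2 : ∀ ω, (P.map Y) (Prod.mk (X ω) ⁻¹' E) = P {ω' | (X ω, Y ω') ∈ E} := fun ω => by
    rw [Measure.map_apply hY (measurable_prodMk_left hE)]
    rfl
  have h3 : P {ω | (X ω, Y ω) ∈ E} = ∫⁻ ω, P {ω' | (X ω, Y ω') ∈ E} ∂P := by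
    have h4 := (indepFun_iff_map_prod_eq_prod_map_map hX.aemeasurable hY.aemeasurable).1 hXY
    calc P {ω | (X ω, Y ω) ∈ E} = P.map (fun ω => (X ω, Y ω)) E := by
          rw [Measure.map_apply (hX.prodMk hY) hE]
          rfl
      _ = ∫⁻ x, (P.map Y) (Prod.mk x ⁻¹' E) ∂(P.map X) := by
          rw [h4, Measure.prod_apply hE]
      _ = ∫⁻ ω, (P.map Y) (Prod.mk (X ω) ⁻¹' E) ∂P := lintegral_map h1 hX
      _ = _ := by simp_rw [h2]
  rw [measureReal_def, h3]
  refine (integral_toReal ?_ (ae_of_all _ fun ω => measure_lt_top P _)).symm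
  refine (h1.comp hX).aemeasurable.congr (ae_of_all _ fun ω => h2 ω)

end Independence

/-! ### Tails after multiplication by the random matrix -/

section Mixture

variable {Ω J : Type*} [MeasurableSpace Ω] {P : Measure Ω}
  {α : ℝ} {q d : ℕ} {V : Ω → Fin d → ℝ≥0} {Z : J → Ω → ℝ≥0} {u : J → Fin d → ℝ≥0}
  {A : Ω → Matrix (Fin q) (Fin d) ℝ≥0} {h : (Fin q → ℝ≥0) → ℝ≥0}

theorem sum_mulVec_le (a : Matrix (Fin q) (Fin d) ℝ≥0) (v : Fin d → ℝ≥0) :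
    ∑ i, (a *ᵥ v) i ≤ (∑ i, ∑ j, a i j) * ∑ j, v j := by
  rw [Finset.sum_mul]
  refine Finset.sum_le_sum fun i _ => ?_
  rw [Matrix.mulVec, dotProduct, Finset.sum_mul]
  refine Finset.sum_le_sum fun j _ => ?_
  gcongr
  exact Finset.single_le_sum (f := v) (fun _ _ => zero_le) (Finset.mem_univ j)

/-- This envelope separates the matrix from the vector, and yields every moment and tail bound
below. -/
theorem exists_le_mul_sum_mul_sum (hh : PosHomogeneous h) (hc : Continuous h) :
    ∃ B : ℝ≥0, ∀ (a : Matrix (Fin q) (Fin d) ℝ≥0) (v : Fin d → ℝ≥0),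
      h (a *ᵥ v) ≤ B * (∑ i, ∑ j, a i j) * ∑ j, v j := by
  obtain ⟨B, hB⟩ := hh.exists_le_mul_sum hc
  refine ⟨B, fun a v => (hB _).trans ?_⟩
  rw [mul_assoc]
  gcongr
  exact sum_mulVec_le a v

theorem measurable_apply_mulVec (hc : Continuous h) :
    Measurable fun p : (Fin q → Fin d → ℝ≥0) × (Fin d → ℝ≥0) => h (Matrix.of p.1 *ᵥ p.2) := by
  have : Continuous fun p : (Fin q → Fin d → ℝ≥0) × (Fin d → ℝ≥0) =>
      h (fun i => ∑ j, p.1 i j * p.2 j) := by fun_prop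
  exact this.measurable

theorem measurable_entries (hA : ∀ i j, Measurable fun ω => A ω i j) :
    Measurable fun ω => (fun i j => A ω i j : Fin q → Fin d → ℝ≥0) :=
  measurable_pi_lambda _ fun i => measurable_pi_lambda _ fun j => hA i j

theorem measurable_apply_mulVec_random (hc : Continuous h)
    (hA : ∀ i j, Measurable fun ω => A ω i j) (hV : Measurable V) :
    Measurable fun ω => h (A ω *ᵥ V ω) :=
  (measurable_apply_mulVec hc).comp ((measurable_entries hA).prodMk hV)

theorem measurable_apply_mulVec_const (hc : Continuous h)
    (hA : ∀ i j, Measurable fun ω => A ω i j) (v : Fin d → ℝ≥0) :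
    Measurable fun ω => h (A ω *ᵥ v) :=
  measurable_apply_mulVec_random hc hA measurable_const

theorem integrable_rpow_apply_mulVec (hα : 0 ≤ α) (hh : PosHomogeneous h) (hc : Continuous h)
    (hA : ∀ i j, Measurable fun ω => A ω i j)
    (hint : Integrable (fun ω => ((∑ i, ∑ j, A ω i j : ℝ≥0) : ℝ) ^ α) P) (v : Fin d → ℝ≥0) :
    Integrable (fun ω => (h (A ω *ᵥ v) : ℝ) ^ α) P := by
  obtain ⟨B, hB⟩ := exists_le_mul_sum_mul_sum (d := d) hh hc
  refine (hint.const_mul ((B * ∑ j, v j : ℝ≥0) ^ α : ℝ)).mono'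
    ((measurable_apply_mulVec_const hc hA v).coe_nnreal_real.pow_const α).aestronglyMeasurable
    (ae_of_all _ fun ω => ?_)
  rw [Real.norm_of_nonneg (by positivity), ← Real.mul_rpow (by positivity) (by positivity)]
  refine Real.rpow_le_rpow (by positivity) ?_ hα
  have := hB (A ω) v
  rw [mul_right_comm] at this
  exact_mod_cast this

variable [IsProbabilityMeasure P]

theorem measureReal_lt_apply_mulVec (hc : Continuous h)
    (hA : ∀ i j, Measurable fun ω => A ω i j) (hV : Measurable V)
    (hAV : IndepFun (fun ω => (fun i j => A ω i j : Fin q → Fin d → ℝ≥0)) V P) (t : ℝ) :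
    P.real {ω | t < (h (A ω *ᵥ V ω) : ℝ)} =
        ∫ ω, P.real {ω' | t < (h (A ω *ᵥ V ω') : ℝ)} ∂P ∧
      Measurable fun ω => P.real {ω' | t < (h (A ω *ᵥ V ω') : ℝ)} := by
  have hE : MeasurableSet {p : (Fin q → Fin d → ℝ≥0) × (Fin d → ℝ≥0) |
      t < (h (Matrix.of p.1 *ᵥ p.2) : ℝ)} :=
    measurableSet_lt measurable_const (measurable_apply_mulVec hc).coe_nnreal_real
  exact ⟨measureReal_eq_integral_of_indepFun (measurable_entries hA) hV hAV hE,
    measurable_measureReal_section (measurable_entries hA) hV hE⟩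

/-- `D` does not depend on the matrix, so the right side is a dominating function for the
integration over `A`. -/
theorem exists_section_tail_bound (hα : 0 < α) (hh : PosHomogeneous h) (hc : Continuous h)
    {C : ℝ} (hC : 0 ≤ C)
    (hS : ∀ t : ℝ, 0 < t → t ^ α * P.real {ω | t < ((∑ k, V ω k : ℝ≥0) : ℝ)} ≤ C) :
    ∃ D : ℝ, 0 ≤ D ∧ ∀ (a : Matrix (Fin q) (Fin d) ℝ≥0) (t : ℝ), 0 < t →
      t ^ α * P.real {ω | t < (h (a *ᵥ V ω) : ℝ)} ≤
        D * ((∑ i, ∑ j, a i j : ℝ≥0) : ℝ) ^ α := by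
  obtain ⟨B, hB⟩ := exists_le_mul_sum_mul_sum (d := d) hh hc
  refine ⟨C * (B : ℝ) ^ α, by positivity, fun a t ht => ?_⟩
  have h1 := tail_bound_const_mul hα hS (c := ((B * ∑ i, ∑ j, a i j : ℝ≥0) : ℝ))
    (NNReal.coe_nonneg _) ht
  rw [NNReal.coe_mul, Real.mul_rpow (by positivity) (by positivity), ← mul_assoc] at h1
  refine le_trans (mul_le_mul_of_nonneg_left (measureReal_mono
    (fun ω (hω : t < (h (a *ᵥ V ω) : ℝ)) => ?_) (measure_ne_top P _))
    (Real.rpow_nonneg ht.le α)) h1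
  refine hω.trans_le ?_
  exact_mod_cast hB a (V ω)

theorem exists_mixture_tail_bound (hα : 0 < α) (hh : PosHomogeneous h) (hc : Continuous h)
    (hA : ∀ i j, Measurable fun ω => A ω i j) (hV : Measurable V)
    (hAV : IndepFun (fun ω => (fun i j => A ω i j : Fin q → Fin d → ℝ≥0)) V P)
    (hint : Integrable (fun ω => ((∑ i, ∑ j, A ω i j : ℝ≥0) : ℝ) ^ α) P)
    {C : ℝ} (hC : 0 ≤ C)
    (hS : ∀ t : ℝ, 0 < t → t ^ α * P.real {ω | t < ((∑ k, V ω k : ℝ≥0) : ℝ)} ≤ C) :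
    ∃ D : ℝ, 0 ≤ D ∧ ∀ t : ℝ, 0 < t → t ^ α * P.real {ω | t < (h (A ω *ᵥ V ω) : ℝ)} ≤ D := by
  obtain ⟨D, hD0, hD⟩ := exists_section_tail_bound (q := q) hα hh hc hC hS
  refine ⟨∫ ω, D * ((∑ i, ∑ j, A ω i j : ℝ≥0) : ℝ) ^ α ∂P,
    integral_nonneg fun ω => by positivity, fun t ht => ?_⟩
  rw [(measureReal_lt_apply_mulVec hc hA hV hAV t).1, ← integral_const_mul]
  exact integral_mono_of_nonneg (ae_of_all _ fun ω => by positivity) (hint.const_mul D)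
    (ae_of_all _ fun ω => hD (A ω) t ht)

/-- For a frozen matrix `a`, the map `v ↦ h(a v)` is continuous and homogeneous, so its tail limit
is known; dominated convergence integrates it over the law of `A`. -/
theorem RayApproximation.tendsto_mixture_tail [Fintype J] (hα : 0 < α)
    (hR : RayApproximation P α V Z u) (hh : PosHomogeneous h) (hc : Continuous h)
    (hA : ∀ i j, Measurable fun ω => A ω i j) (hV : Measurable V)
    (hAV : IndepFun (fun ω => (fun i j => A ω i j : Fin q → Fin d → ℝ≥0)) V P)
    (hint : Integrable (fun ω => ((∑ i, ∑ j, A ω i j : ℝ≥0) : ℝ) ^ α) P)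
    {C : ℝ} (hC : 0 ≤ C)
    (hS : ∀ t : ℝ, 0 < t → t ^ α * P.real {ω | t < ((∑ k, V ω k : ℝ≥0) : ℝ)} ≤ C) :
    Tendsto (fun t : ℝ => t ^ α * P.real {ω | t < (h (A ω *ᵥ V ω) : ℝ)}) atTop
      (𝓝 (∑ j, ∫ ω, (h (A ω *ᵥ u j) : ℝ) ^ α ∂P)) := by
  obtain ⟨D, hD0, hD⟩ := exists_section_tail_bound (q := q) hα hh hc hC hS
  rw [← integral_finsetSum _ fun j _ => integrable_rpow_apply_mulVec hα.le hh hc hA hint (u j)]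
  have hcongr : (fun t : ℝ => t ^ α * P.real {ω | t < (h (A ω *ᵥ V ω) : ℝ)}) = fun t : ℝ =>
      ∫ ω, t ^ α * P.real {ω' | t < (h (A ω *ᵥ V ω') : ℝ)} ∂P := by
    ext t
    rw [(measureReal_lt_apply_mulVec hc hA hV hAV t).1, ← integral_const_mul]
  rw [hcongr]
  refine tendsto_integral_filter_of_dominated_convergence
    (fun ω => D * ((∑ i, ∑ j, A ω i j : ℝ≥0) : ℝ) ^ α)
    (Eventually.of_forall fun t => ((measureReal_lt_apply_mulVec hc hA hV hAV t).2.const_mul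
      _).aestronglyMeasurable) ?_ (hint.const_mul D) (ae_of_all _ fun ω => ?_)
  · filter_upwards [eventually_gt_atTop 0] with t ht
    refine ae_of_all _ fun ω => ?_
    rw [Real.norm_of_nonneg (mul_nonneg (Real.rpow_nonneg ht.le α) measureReal_nonneg)]
    exact hD (A ω) t ht
  · have hcont : Continuous fun v : Fin d → ℝ≥0 => h (A ω *ᵥ v) := by
      have : Continuous fun v : Fin d → ℝ≥0 => h (fun i => ∑ j, A ω i j * v j) := by fun_prop
      exact this
    exact hR.tendsto_tail hα hV hS (hh.comp_mulVec (A ω)) hcont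

end Mixture

/-! ### Tail expectations from joint tails -/

section LayerCake

variable {α : ℝ}

theorem integrableOn_min_one_rpow (hα : 1 < α) :
    IntegrableOn (fun s : ℝ => min 1 (s ^ (-α))) (Set.Ioi 0) := by
  have hm : Measurable fun s : ℝ => min 1 (s ^ (-α)) := by fun_prop
  rw [← Set.Ioc_union_Ioi_eq_Ioi zero_le_one]
  refine IntegrableOn.union ?_ ?_
  · refine Measure.integrableOn_of_bounded (M := 1) measure_Ioc_lt_top.ne hm.aestronglyMeasurable ?_
    filter_upwards [ae_restrict_mem measurableSet_Ioc] with s hs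
    rw [Real.norm_of_nonneg (le_min zero_le_one (Real.rpow_nonneg hs.1.le _))]
    exact min_le_left _ _
  · refine (integrableOn_Ioi_rpow_of_lt (by linarith : -α < -1) one_pos).mono'
      hm.aestronglyMeasurable ?_
    filter_upwards [ae_restrict_mem measurableSet_Ioi] with s hs
    have hs : 1 < s := hs
    rw [Real.norm_of_nonneg (le_min zero_le_one (Real.rpow_nonneg (by linarith) _))]
    exact min_le_right _ _

/-- Splitting at `s = x/y`, the constant piece `y^α` contributes `x y^{α-1}` and the piece `(x/s)^α`
contributes `x y^{α-1}/(α-1)`. -/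
theorem integral_min_div_rpow (hα : 1 < α) {x y : ℝ} (hx : 0 ≤ x) (hy : 0 ≤ y) :
    ∫ s in Set.Ioi 0, min (x / s) y ^ α = α / (α - 1) * (x * y ^ (α - 1)) := by
  have hα0 : α ≠ 0 := by linarith
  rcases hx.eq_or_lt with rfl | hx
  · rw [zero_mul, mul_zero]
    simp [hy, Real.zero_rpow hα0]
  rcases hy.eq_or_lt with rfl | hy
  · rw [Real.zero_rpow (by linarith), mul_zero, mul_zero]
    refine setIntegral_eq_zero_of_forall_eq_zero fun s hs => ?_
    have hs : 0 < s := hs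
    rw [min_eq_right (by positivity), Real.zero_rpow hα0]
  have hxy : 0 < x / y := div_pos hx hy
  have h1 : ∀ s ∈ Set.Ioc 0 (x / y), min (x / s) y ^ α = y ^ α := by
    intro s hs
    rw [min_eq_right]
    rw [le_div_iff₀ hs.1, mul_comm, ← le_div_iff₀ hy]
    exact hs.2
  have h2 : ∀ s ∈ Set.Ioi (x / y), min (x / s) y ^ α = x ^ α * s ^ (-α) := by
    intro s hs
    have hs' : x / y < s := hs
    have hs0 : 0 < s := hxy.trans hs'
    rw [min_eq_left, Real.div_rpow hx.le hs0.le, Real.rpow_neg hs0.le, div_eq_mul_inv]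
    rw [div_le_iff₀ hs0, mul_comm, ← div_le_iff₀ hy]
    exact hs'.le
  have hi2 : IntegrableOn (fun s : ℝ => min (x / s) y ^ α) (Set.Ioi (x / y)) :=
    IntegrableOn.congr_fun
      ((integrableOn_Ioi_rpow_of_lt (by linarith : -α < -1) hxy).const_mul (x ^ α))
      (fun s hs => (h2 s hs).symm) measurableSet_Ioi
  have hi1 : IntegrableOn (fun s : ℝ => min (x / s) y ^ α) (Set.Ioc 0 (x / y)) :=
    (integrableOn_const (C := y ^ α) measure_Ioc_lt_top.ne).congr_fun
      (fun s hs => (h1 s hs).symm) measurableSet_Ioc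
  rw [← Set.Ioc_union_Ioi_eq_Ioi hxy.le, setIntegral_union (Set.Ioc_disjoint_Ioi le_rfl)
    measurableSet_Ioi hi1 hi2, setIntegral_congr_fun measurableSet_Ioc h1,
    setIntegral_congr_fun measurableSet_Ioi h2, integral_const_mul,
    integral_Ioi_rpow_of_lt (by linarith) hxy, setIntegral_const, Real.volume_real_Ioc_of_le hxy.le,
    Real.div_rpow hx.le hy.le]
  have e1 : y ^ (α - 1) = y ^ α / y := Real.rpow_sub_one hy.ne' α
  have e2 : x ^ (-α + 1) = (x ^ α)⁻¹ * x := by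
    rw [Real.rpow_add_one hx.ne', Real.rpow_neg hx.le]
  have e3 : y ^ (-α + 1) = (y ^ α)⁻¹ * y := by
    rw [Real.rpow_add_one hy.ne', Real.rpow_neg hy.le]
  rw [e1, e2, e3]
  have hxα := (Real.rpow_pos_of_pos hx α).ne'
  have hyα := (Real.rpow_pos_of_pos hy α).ne'
  have h3 : α - 1 ≠ 0 := by linarith
  have h4 : -α + 1 ≠ 0 := by linarith
  have h5 : -α + 1 = -(α - 1) := by ring
  rw [h5, smul_eq_mul]
  field_simp
  ring

variable {Ω : Type*} [MeasurableSpace Ω] {P : Measure Ω}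

/-- The integrand is at most `min(1, s^{-α}) (X^α + Y^α)`. -/
theorem integrable_uncurry_min_div_rpow [SFinite P] (hα : 1 < α) {X Y : Ω → ℝ}
    (hX0 : ∀ ω, 0 ≤ X ω) (hY0 : ∀ ω, 0 ≤ Y ω) (hX : Measurable X) (hY : Measurable Y)
    (hXi : Integrable (fun ω => X ω ^ α) P) (hYi : Integrable (fun ω => Y ω ^ α) P) :
    Integrable (fun p : ℝ × Ω => min (X p.2 / p.1) (Y p.2) ^ α)
      ((volume.restrict (Set.Ioi 0)).prod P) := by
  refine ((integrableOn_min_one_rpow hα).mul_prod (hXi.add hYi)).mono' ?_ ?_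
  · exact ((((hX.comp measurable_snd).div measurable_fst).min
      (hY.comp measurable_snd)).pow_const α).aestronglyMeasurable
  · filter_upwards [Measure.quasiMeasurePreserving_fst.ae
      (ae_restrict_mem (μ := volume) (measurableSet_Ioi (a := (0 : ℝ))))] with p hp
    have hp : 0 < p.1 := hp
    have hX1 := hX0 p.2
    have hY1 := hY0 p.2
    have hmin : 0 ≤ min (X p.2 / p.1) (Y p.2) := le_min (by positivity) hY1
    have hα0 : 0 ≤ α := by linarith
    have hXα := Real.rpow_nonneg hX1 α
    have hYα := Real.rpow_nonneg hY1 α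
    have hsα := Real.rpow_nonneg hp.le (-α)
    rw [Real.norm_of_nonneg (Real.rpow_nonneg hmin α)]
    simp only [Pi.add_apply]
    rcases le_total 1 (p.1 ^ (-α)) with h | h
    · rw [min_eq_left h, one_mul]
      have := Real.rpow_le_rpow hmin (min_le_right _ _) hα0
      linarith
    · rw [min_eq_right h]
      have := Real.rpow_le_rpow hmin (min_le_left _ _) hα0
      rw [Real.div_rpow hX1 hp.le, div_eq_mul_inv (X p.2 ^ α), ← Real.rpow_neg hp.le] at this
      nlinarith

/-- Fubini; integrability of `X Y^{α-1}` is a by-product, being a multiple of the inner integral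
over `s`. -/
theorem integral_integral_min_div_rpow [SFinite P] (hα : 1 < α) {X Y : Ω → ℝ}
    (hX0 : ∀ ω, 0 ≤ X ω) (hY0 : ∀ ω, 0 ≤ Y ω) (hX : Measurable X) (hY : Measurable Y)
    (hXi : Integrable (fun ω => X ω ^ α) P) (hYi : Integrable (fun ω => Y ω ^ α) P) :
    Integrable (fun ω => X ω * Y ω ^ (α - 1)) P ∧
      ∫ s in Set.Ioi 0, ∫ ω, min (X ω / s) (Y ω) ^ α ∂P =
        α / (α - 1) * ∫ ω, X ω * Y ω ^ (α - 1) ∂P := by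
  have hint := integrable_uncurry_min_div_rpow hα hX0 hY0 hX hY hXi hYi
  have h1 : ∀ ω, ∫ s in Set.Ioi 0, min (X ω / s) (Y ω) ^ α =
      α / (α - 1) * (X ω * Y ω ^ (α - 1)) := fun ω =>
    integral_min_div_rpow hα (hX0 ω) (hY0 ω)
  constructor
  · have h2 := hint.integral_prod_right
    simp only [h1] at h2
    have h3 : α / (α - 1) ≠ 0 := div_ne_zero (by linarith) (by linarith)
    exact (integrable_const_mul_iff (Ne.isUnit h3) _).1 h2
  · rw [integral_integral_swap hint, ← integral_const_mul]
    simp only [h1]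

variable [IsProbabilityMeasure P]

theorem integrable_of_tail_bound (hα : 1 < α) {X : Ω → ℝ} (hX0 : ∀ ω, 0 ≤ X ω)
    (hX : Measurable X) {D : ℝ}
    (hD : ∀ t : ℝ, 0 < t → t ^ α * P.real {ω | t < X ω} ≤ D) : Integrable X P := by
  refine ⟨hX.aestronglyMeasurable, ?_⟩
  rw [hasFiniteIntegral_iff_ofReal (ae_of_all _ hX0),
    lintegral_eq_lintegral_meas_lt P (ae_of_all _ hX0) hX.aemeasurable]
  refine lt_of_le_of_lt ?_ ((integrableOn_min_one_rpow hα).const_mul (max 1 D)).lintegral_lt_top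
  refine setLIntegral_mono_ae' measurableSet_Ioi (ae_of_all _ fun s hs => ?_)
  have hs : 0 < s := hs
  rw [← ofReal_measureReal]
  refine ENNReal.ofReal_le_ofReal ?_
  have hsα : 0 < s ^ α := Real.rpow_pos_of_pos hs α
  have h1 : P.real {ω | s < X ω} ≤ D * s ^ (-α) := by
    rw [Real.rpow_neg hs.le, ← div_eq_mul_inv, le_div_iff₀ hsα, mul_comm]
    exact hD s hs
  have h2 : P.real {ω | s < X ω} ≤ 1 := measureReal_le_one
  have h3 : 0 ≤ s ^ (-α) := Real.rpow_nonneg hs.le _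
  rcases le_total 1 (s ^ (-α)) with h | h
  · rw [min_eq_left h, mul_one]
    exact h2.trans (le_max_left _ _)
  · rw [min_eq_right h]
    exact h1.trans (mul_le_mul_of_nonneg_right (le_max_right _ _) h3)

/-- Tail expectations of `X` on the event `t < Y` from the joint tails of `X` and `Y`. -/
theorem tendsto_setIntegral_of_tendsto_min_tail (hα : 1 < α) {X Y : Ω → ℝ}
    (hX0 : ∀ ω, 0 ≤ X ω) (hX : Measurable X) {D E : ℝ}
    (hD : ∀ t : ℝ, 0 < t → t ^ α * P.real {ω | t < X ω} ≤ D)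
    (hE : ∀ t : ℝ, 0 < t → t ^ α * P.real {ω | t < Y ω} ≤ E) {Λ : ℝ → ℝ}
    (hΛ : ∀ s : ℝ, 0 < s → Tendsto (fun t : ℝ => t ^ α * P.real {ω | t < min (X ω / s) (Y ω)})
      atTop (𝓝 (Λ s))) :
    Tendsto (fun t : ℝ => t ^ (α - 1) * ∫ ω in {ω | t < Y ω}, X ω ∂P) atTop
      (𝓝 (∫ s in Set.Ioi 0, Λ s)) := by
  have hXi := integrable_of_tail_bound hα hX0 hX hD
  have hset : ∀ s : ℝ, 0 < s → ∀ t : ℝ,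
      {ω | t < min (X ω / s) (Y ω)} = {ω | t * s < X ω} ∩ {ω | t < Y ω} := by
    intro s hs t
    ext ω
    simp only [Set.mem_inter_iff, Set.mem_ofPred_eq, lt_min_iff, lt_div_iff₀ hs]
  -- Layer cake with the levels of `X` rescaled to `t s`; the substitution supplies the extra factor
  -- `t`.
  have hlayer : ∀ t : ℝ, 0 < t → t ^ (α - 1) * ∫ ω in {ω | t < Y ω}, X ω ∂P =
      ∫ s in Set.Ioi 0, t ^ α * P.real ({ω | t * s < X ω} ∩ {ω | t < Y ω}) := by
    intro t ht
    rw [hXi.restrict.integral_eq_integral_meas_lt (ae_of_all _ hX0)]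
    have h1 := integral_comp_mul_left_Ioi
      (fun s => (P.restrict {ω | t < Y ω}).real {ω | s < X ω}) 0 ht
    rw [mul_zero, smul_eq_mul] at h1
    rw [integral_const_mul]
    have h2 : ∀ s, (P.restrict {ω | t < Y ω}).real {ω | t * s < X ω} =
        P.real ({ω | t * s < X ω} ∩ {ω | t < Y ω}) := fun s =>
      measureReal_restrict_apply (measurableSet_lt measurable_const hX)
    simp only [← h2]
    rw [h1, Real.rpow_sub_one ht.ne']
    field_simp
  have hlim : Tendsto (fun t : ℝ => ∫ s in Set.Ioi 0,
      t ^ α * P.real ({ω | t * s < X ω} ∩ {ω | t < Y ω})) atTop (𝓝 (∫ s in Set.Ioi 0, Λ s)) := by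
    refine tendsto_integral_filter_of_dominated_convergence
      (fun s => max D E * min 1 (s ^ (-α))) ?_ ?_
      ((integrableOn_min_one_rpow hα).const_mul _) ?_
    · filter_upwards [eventually_gt_atTop 0] with t ht
      -- Measurability in `s` comes from monotonicity.
      refine Measurable.aestronglyMeasurable (Measurable.const_mul (Antitone.measurable ?_) _)
      intro s s' hss
      refine measureReal_mono (fun ω hω => ⟨?_, hω.2⟩) (measure_ne_top P _)
      exact lt_of_le_of_lt (mul_le_mul_of_nonneg_left hss ht.le) hω.1
    · filter_upwards [eventually_gt_atTop 0] with t ht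
      filter_upwards [ae_restrict_mem measurableSet_Ioi] with s hs
      have hs : 0 < s := hs
      have htα := Real.rpow_nonneg ht.le α
      have hsα := Real.rpow_nonneg hs.le (-α)
      have hsα' : 0 < s ^ α := Real.rpow_pos_of_pos hs α
      rw [Real.norm_of_nonneg (by positivity)]
      -- For small `s` the tail of `Y` at `t` dominates, for large `s` the tail of `X` at `t s`.
      rcases le_total 1 (s ^ (-α)) with h | h
      · rw [min_eq_left h, mul_one]
        refine le_trans ?_ ((hE t ht).trans (le_max_right _ _))
        exact mul_le_mul_of_nonneg_left
          (measureReal_mono Set.inter_subset_right (measure_ne_top P _)) htα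
      · rw [min_eq_right h]
        have h1 := hD (t * s) (by positivity)
        rw [Real.mul_rpow ht.le hs.le] at h1
        have h2 : t ^ α * P.real {ω | t * s < X ω} ≤ D * s ^ (-α) := by
          rw [Real.rpow_neg hs.le, ← div_eq_mul_inv, le_div_iff₀ hsα']
          linarith
        calc t ^ α * P.real ({ω | t * s < X ω} ∩ {ω | t < Y ω})
            ≤ t ^ α * P.real {ω | t * s < X ω} := mul_le_mul_of_nonneg_left
              (measureReal_mono Set.inter_subset_left (measure_ne_top P _)) htα
          _ ≤ D * s ^ (-α) := h2
          _ ≤ _ := mul_le_mul_of_nonneg_right (le_max_left _ _) hsα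
    · filter_upwards [ae_restrict_mem measurableSet_Ioi] with s hs
      have := hΛ s hs
      simpa only [hset s hs] using this
  refine hlim.congr' ?_
  filter_upwards [eventually_gt_atTop 0] with t ht
  exact (hlayer t ht).symm

end LayerCake

/-! ### Conditional means, VaR and CoTE -/

section ConditionalTails

variable {Ω : Type*} [MeasurableSpace Ω] {P : Measure Ω} [IsProbabilityMeasure P] {α : ℝ}

omit [IsProbabilityMeasure P] in
theorem condMean_eq (Y : Ω → ℝ) (S : Set Ω) :
    condMean P Y S = (P.real S)⁻¹ * ∫ ω in S, Y ω ∂P := by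
  rw [condMean, ProbabilityTheory.cond, integral_smul_measure, ENNReal.toReal_inv, smul_eq_mul]
  rfl

omit [IsProbabilityMeasure P] in
theorem tendsto_condMean_div {X Y : Ω → ℝ} {C D : ℝ} (hC : C ≠ 0)
    (hY : Tendsto (fun t : ℝ => t ^ α * P.real {ω | t < Y ω}) atTop (𝓝 C))
    (hX : Tendsto (fun t : ℝ => t ^ (α - 1) * ∫ ω in {ω | t < Y ω}, X ω ∂P) atTop (𝓝 D)) :
    Tendsto (fun t : ℝ => condMean P X {ω | t < Y ω} / t) atTop (𝓝 (D / C)) := by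
  refine (hX.div hY hC).congr' ?_
  filter_upwards [eventually_gt_atTop 0] with t ht
  have := (Real.rpow_pos_of_pos ht α).ne'
  simp only [Pi.div_apply]
  rw [condMean_eq, Real.rpow_sub_one ht.ne']
  field_simp

theorem measure_ne_zero_of_tendsto_tail {Y : Ω → ℝ} {C : ℝ} (hC : 0 < C)
    (hY : Tendsto (fun t : ℝ => t ^ α * P.real {ω | t < Y ω}) atTop (𝓝 C)) (t : ℝ) :
    P {ω | t < Y ω} ≠ 0 := by
  obtain ⟨s, h1, hs, hts⟩ := ((hY.eventually (lt_mem_nhds hC)).and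
    ((eventually_gt_atTop 0).and (eventually_ge_atTop t))).exists
  have h2 : 0 < P.real {ω | s < Y ω} := pos_of_mul_pos_right h1 (Real.rpow_nonneg hs.le α)
  have h3 : P.real {ω | s < Y ω} ≤ P.real {ω | t < Y ω} :=
    measureReal_mono (fun ω (hω : s < Y ω) => hts.trans_lt hω) (measure_ne_top P _)
  intro h0
  rw [measureReal_def P {ω | t < Y ω}, h0, ENNReal.toReal_zero] at h3
  linarith

/-- The function `r(γ) = C^{1/α} γ^{-1/α}` solves `C r^{-α} = γ`, so `P(X > c r(γ)) / γ → c^{-α}`.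
This limit is above `1` for `c < 1` and below `1` for `c > 1`, which traps the quantile between
multiples of `r(γ)`. -/
theorem isEquivalent_valueAtRisk (hα : 0 < α) {X : Ω → ℝ} {C : ℝ} (hC : 0 < C)
    (hX : Tendsto (fun t : ℝ => t ^ α * P.real {ω | t < X ω}) atTop (𝓝 C)) :
    (fun γ : ℝ => valueAtRisk P X γ) ~[𝓝[>] 0] (fun γ : ℝ => C ^ (1 / α) * γ ^ (-1 / α)) ∧
      Tendsto (fun γ : ℝ => C ^ (1 / α) * γ ^ (-1 / α)) (𝓝[>] 0) atTop := by
  set r : ℝ → ℝ := fun γ => C ^ (1 / α) * γ ^ (-1 / α) with hr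
  have hCα : 0 < C ^ (1 / α) := Real.rpow_pos_of_pos hC _
  have hrpos : ∀ γ : ℝ, 0 < γ → 0 < r γ := fun γ hγ => mul_pos hCα (Real.rpow_pos_of_pos hγ _)
  have hrα : ∀ γ : ℝ, 0 < γ → r γ ^ α * γ = C := by
    intro γ hγ
    rw [hr, Real.mul_rpow hCα.le (Real.rpow_nonneg hγ.le _), ← Real.rpow_mul hC.le,
      ← Real.rpow_mul hγ.le, one_div_mul_cancel hα.ne', div_mul_cancel₀ _ hα.ne', Real.rpow_one,
      Real.rpow_neg_one, mul_assoc, inv_mul_cancel₀ hγ.ne', mul_one]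
  have hrtop : Tendsto r (𝓝[>] 0) atTop := by
    refine Tendsto.const_mul_atTop hCα ?_
    refine tendsto_rpow_neg_nhdsGT_zero ?_
    exact div_neg_of_neg_of_pos (by norm_num) hα
  refine ⟨?_, hrtop⟩
  have hratio : ∀ c : ℝ, 0 < c →
      Tendsto (fun γ : ℝ => P.real {ω | c * r γ < X ω} / γ) (𝓝[>] 0) (𝓝 ((c ^ α)⁻¹)) := by
    intro c hc
    have h1 := (hX.comp (hrtop.const_mul_atTop hc)).div_const (c ^ α * C)
    have h2 : C / (c ^ α * C) = (c ^ α)⁻¹ := by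
      have := (Real.rpow_pos_of_pos hc α).ne'
      field_simp
    rw [h2] at h1
    refine h1.congr' ?_
    filter_upwards [self_mem_nhdsWithin] with γ hγ
    have hγ : 0 < γ := hγ
    have h3 := hrα γ hγ
    have h4 := (Real.rpow_pos_of_pos hc α).ne'
    have h5 := (Real.rpow_pos_of_pos (hrpos γ hγ) α).ne'
    simp only [Function.comp]
    rw [Real.mul_rpow hc.le (hrpos γ hγ).le, ← h3]
    field_simp
  have hupper : ∀ c : ℝ, 1 < c → ∀ᶠ γ : ℝ in 𝓝[>] 0,
      P.real {ω | c * r γ < X ω} ≤ γ := by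
    intro c hc
    have hlt : (c ^ α)⁻¹ < 1 := inv_lt_one_of_one_lt₀ (Real.one_lt_rpow hc hα)
    filter_upwards [(hratio c (by linarith)).eventually (gt_mem_nhds hlt), self_mem_nhdsWithin]
      with γ h1 hγ
    have hγ : 0 < γ := hγ
    rw [div_lt_one hγ] at h1
    exact h1.le
  have hbdd : ∀ γ, BddBelow {t : ℝ | 0 ≤ t ∧ P.real {ω | t < X ω} ≤ γ} := fun γ =>
    ⟨0, fun t ht => ht.1⟩
  have hdiv : Tendsto (fun γ : ℝ => valueAtRisk P X γ / r γ) (𝓝[>] 0) (𝓝 1) := by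
    refine tendsto_order.2 ⟨fun a ha => ?_, fun a ha => ?_⟩
    · obtain ⟨c, hc1, hc2⟩ := exists_between (max_lt ha one_pos)
      have hc0 : 0 < c := (le_max_right _ _).trans_lt hc1
      have hlt : 1 < (c ^ α)⁻¹ :=
        (one_lt_inv₀ (Real.rpow_pos_of_pos hc0 α)).2 (Real.rpow_lt_one hc0.le hc2 hα)
      filter_upwards [(hratio c hc0).eventually (lt_mem_nhds hlt), hupper 2 one_lt_two,
        self_mem_nhdsWithin] with γ h1 h2 hγ
      have hγ : 0 < γ := hγ
      have hrγ := hrpos γ hγ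
      rw [one_lt_div hγ] at h1
      refine ((le_max_left a 0).trans_lt hc1).trans_le ?_
      rw [le_div_iff₀ hrγ]
      -- The point `2 r(γ)` witnesses that the set is nonempty; the real infimum of the empty set
      -- would be the default `0`.
      refine le_csInf ⟨2 * r γ, by positivity, h2⟩ fun t ht => ?_
      by_contra hlt
      rw [not_le] at hlt
      have h3 : P.real {ω | c * r γ < X ω} ≤ P.real {ω | t < X ω} :=
        measureReal_mono (fun ω (hω : c * r γ < X ω) => hlt.trans hω) (measure_ne_top P _)
      linarith [ht.2]
    · obtain ⟨c, hc1, hc2⟩ := exists_between ha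
      filter_upwards [hupper c hc1, self_mem_nhdsWithin] with γ h1 hγ
      have hγ : 0 < γ := hγ
      have hrγ := hrpos γ hγ
      refine lt_of_le_of_lt ?_ hc2
      rw [div_le_iff₀ hrγ]
      exact csInf_le (hbdd γ) ⟨by positivity, h1⟩
  exact isEquivalent_of_tendsto_one hdiv

/-- CoTE is the conditional mean at level `t = VaR`, and VaR tends to infinity as `γ ↓ 0`. -/
theorem classicalCoTEAsymptotics_of_tendsto (hα : 1 < α) {X : Ω → ℝ} {C : ℝ} (hC : 0 < C)
    (hX : Tendsto (fun t : ℝ => t ^ α * P.real {ω | t < X ω}) atTop (𝓝 C))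
    (hcond : Tendsto (fun t : ℝ => condMean P X {ω | t < X ω} / t) atTop
      (𝓝 (α / (α - 1)))) : ClassicalCoTEAsymptotics P X α C := by
  have hα1 : α / (α - 1) ≠ 0 := div_ne_zero (by linarith) (by linarith)
  obtain ⟨hVaR, hrtop⟩ := isEquivalent_valueAtRisk (by linarith) hC hX
  have h1 : (fun t : ℝ => condMean P X {ω | t < X ω}) ~[atTop]
      (fun t : ℝ => α / (α - 1) * t) := by
    refine isEquivalent_of_tendsto_one ?_
    have h2 := hcond.div_const (α / (α - 1))
    rw [div_self hα1] at h2
    refine h2.congr fun t => ?_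
    rw [Pi.div_apply, div_div, mul_comm t]
  exact ⟨h1, h1.comp_tendsto (hVaR.symm.tendsto_atTop hrtop), IsEquivalent.refl.mul hVaR⟩

end ConditionalTails

/-! ### Asymptotics for the exposures under a ray approximation -/

section Model

variable {Ω J : Type*} [MeasurableSpace Ω] {P : Measure Ω} [IsProbabilityMeasure P] [Fintype J]
  {α : ℝ} {q d : ℕ} {V : Ω → Fin d → ℝ≥0} {Z : J → Ω → ℝ≥0} {u : J → Fin d → ℝ≥0}
  {A : Ω → Matrix (Fin q) (Fin d) ℝ≥0} {g h : (Fin q → ℝ≥0) → ℝ≥0}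

/-- Tail expectations of homogeneous functionals of the exposure `A V`, when the extremes of `V`
are approximated by rays. -/
theorem RayApproximation.tendsto_setIntegral (hα : 1 < α)
    (hR : RayApproximation P α V Z u) (hg : PosHomogeneous g) (hgc : Continuous g)
    (hh : PosHomogeneous h) (hc : Continuous h)
    (hA : ∀ i j, Measurable fun ω => A ω i j) (hV : Measurable V)
    (hAV : IndepFun (fun ω => (fun i j => A ω i j : Fin q → Fin d → ℝ≥0)) V P)
    (hint : Integrable (fun ω => ((∑ i, ∑ j, A ω i j : ℝ≥0) : ℝ) ^ α) P)
    {C : ℝ} (hC : 0 ≤ C)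
    (hS : ∀ t : ℝ, 0 < t → t ^ α * P.real {ω | t < ((∑ k, V ω k : ℝ≥0) : ℝ)} ≤ C) :
    Integrable (fun ω => (g (A ω *ᵥ V ω) : ℝ)) P ∧
    (∀ j, Integrable (fun ω => (g (A ω *ᵥ u j) : ℝ) * (h (A ω *ᵥ u j) : ℝ) ^ (α - 1)) P) ∧
    Tendsto (fun t : ℝ => t ^ (α - 1) *
        ∫ ω in {ω | t < (h (A ω *ᵥ V ω) : ℝ)}, (g (A ω *ᵥ V ω) : ℝ) ∂P) atTop
      (𝓝 (α / (α - 1) *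
        ∑ j, ∫ ω, (g (A ω *ᵥ u j) : ℝ) * (h (A ω *ᵥ u j) : ℝ) ^ (α - 1) ∂P)) := by
  have hα0 : 0 < α := by linarith
  obtain ⟨D, -, hD⟩ := exists_mixture_tail_bound hα0 hg hgc hA hV hAV hint hC hS
  obtain ⟨E, -, hE⟩ := exists_mixture_tail_bound hα0 hh hc hA hV hAV hint hC hS
  have hgm := (measurable_apply_mulVec_random hgc hA hV).coe_nnreal_real
  have hu : ∀ j, _ := fun j => integral_integral_min_div_rpow (P := P) hα
    (X := fun ω => (g (A ω *ᵥ u j) : ℝ)) (Y := fun ω => (h (A ω *ᵥ u j) : ℝ))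
    (fun ω => NNReal.coe_nonneg _) (fun ω => NNReal.coe_nonneg _)
    (measurable_apply_mulVec_const hgc hA (u j)).coe_nnreal_real
    (measurable_apply_mulVec_const hc hA (u j)).coe_nnreal_real
    (integrable_rpow_apply_mulVec hα0.le hg hgc hA hint (u j))
    (integrable_rpow_apply_mulVec hα0.le hh hc hA hint (u j))
  refine ⟨integrable_of_tail_bound hα (fun ω => NNReal.coe_nonneg _) hgm hD,
    fun j => (hu j).1, ?_⟩
  have key := tendsto_setIntegral_of_tendsto_min_tail (P := P) hα
    (X := fun ω => (g (A ω *ᵥ V ω) : ℝ)) (Y := fun ω => (h (A ω *ᵥ V ω) : ℝ))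
    (fun ω => NNReal.coe_nonneg _) hgm hD hE
    (Λ := fun s => ∑ j, ∫ ω, min ((g (A ω *ᵥ u j) : ℝ) / s) (h (A ω *ᵥ u j)) ^ α ∂P)
    (fun s hs => ?_)
  · rw [integral_finsetSum _ fun j _ => ?_] at key
    · simp_rw [(hu _).2] at key
      rwa [← Finset.mul_sum] at key
    · exact (integrable_uncurry_min_div_rpow (P := P) hα
        (X := fun ω => (g (A ω *ᵥ u j) : ℝ)) (Y := fun ω => (h (A ω *ᵥ u j) : ℝ))
        (fun ω => NNReal.coe_nonneg _) (fun ω => NNReal.coe_nonneg _)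
        (measurable_apply_mulVec_const hgc hA (u j)).coe_nnreal_real
        (measurable_apply_mulVec_const hc hA (u j)).coe_nnreal_real
        (integrable_rpow_apply_mulVec hα0.le hg hgc hA hint (u j))
        (integrable_rpow_apply_mulVec hα0.le hh hc hA hint (u j))).integral_prod_left
  · lift s to ℝ≥0 using hs.le
    -- The joint tail of `g/s` and `h` is the tail of one homogeneous function, so the mixture limit
    -- applies to it.
    have hmc : Continuous fun x => min (g x / s) (h x) := by fun_prop
    have := hR.tendsto_mixture_tail hα0 (hg.min_div hh s) hmc hA hV hAV hint hC hS
    simpa only [NNReal.coe_min, NNReal.coe_div] using this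

theorem RayApproximation.condMean_asymptotics (hα : 1 < α)
    (hR : RayApproximation P α V Z u) (hg : PosHomogeneous g) (hgc : Continuous g)
    (hh : PosHomogeneous h) (hc : Continuous h)
    (hA : ∀ i j, Measurable fun ω => A ω i j) (hV : Measurable V)
    (hAV : IndepFun (fun ω => (fun i j => A ω i j : Fin q → Fin d → ℝ≥0)) V P)
    (hint : Integrable (fun ω => ((∑ i, ∑ j, A ω i j : ℝ≥0) : ℝ) ^ α) P)
    {C : ℝ} (hC : 0 ≤ C)
    (hS : ∀ t : ℝ, 0 < t → t ^ α * P.real {ω | t < ((∑ k, V ω k : ℝ≥0) : ℝ)} ≤ C)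
    {c : ℝ} (hc0 : 0 < c) (hcsum : c = ∑ j, ∫ ω, (h (A ω *ᵥ u j) : ℝ) ^ α ∂P) :
    Integrable (fun ω => (g (A ω *ᵥ V ω) : ℝ)) P ∧
    (∀ t : ℝ, P {ω | t < (h (A ω *ᵥ V ω) : ℝ)} ≠ 0) ∧
    (∀ j, Integrable (fun ω => (g (A ω *ᵥ u j) : ℝ) * (h (A ω *ᵥ u j) : ℝ) ^ (α - 1)) P) ∧
    Tendsto (fun t : ℝ => condMean P (fun ω => (g (A ω *ᵥ V ω) : ℝ))
        {ω | t < (h (A ω *ᵥ V ω) : ℝ)} / t) atTop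
      (𝓝 (α / (α - 1) * c⁻¹ *
        ∑ j, ∫ ω, (g (A ω *ᵥ u j) : ℝ) * (h (A ω *ᵥ u j) : ℝ) ^ (α - 1) ∂P)) := by
  have htail := hR.tendsto_mixture_tail (by linarith) hh hc hA hV hAV hint hC hS
  rw [← hcsum] at htail
  obtain ⟨h1, h2, h3⟩ := hR.tendsto_setIntegral hα hg hgc hh hc hA hV hAV hint hC hS
  refine ⟨h1, measure_ne_zero_of_tendsto_tail hc0 htail, h2, ?_⟩
  have h4 := tendsto_condMean_div hc0.ne' htail h3
  rwa [mul_div_right_comm, div_eq_mul_inv (α / (α - 1))] at h4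

/-- For `g = h` the product `h · h^{α-1}` is `h^α`, so the limiting sum equals `c` and cancels. -/
theorem RayApproximation.classicalCoTEAsymptotics (hα : 1 < α)
    (hR : RayApproximation P α V Z u)
    (hh : PosHomogeneous h) (hc : Continuous h)
    (hA : ∀ i j, Measurable fun ω => A ω i j) (hV : Measurable V)
    (hAV : IndepFun (fun ω => (fun i j => A ω i j : Fin q → Fin d → ℝ≥0)) V P)
    (hint : Integrable (fun ω => ((∑ i, ∑ j, A ω i j : ℝ≥0) : ℝ) ^ α) P)
    {C : ℝ} (hC : 0 ≤ C)
    (hS : ∀ t : ℝ, 0 < t → t ^ α * P.real {ω | t < ((∑ k, V ω k : ℝ≥0) : ℝ)} ≤ C)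
    {c : ℝ} (hc0 : 0 < c) (hcsum : c = ∑ j, ∫ ω, (h (A ω *ᵥ u j) : ℝ) ^ α ∂P) :
    ClassicalCoTEAsymptotics P (fun ω => (h (A ω *ᵥ V ω) : ℝ)) α c := by
  have htail := hR.tendsto_mixture_tail (by linarith) hh hc hA hV hAV hint hC hS
  rw [← hcsum] at htail
  refine classicalCoTEAsymptotics_of_tendsto hα hc0 htail ?_
  have h1 := (hR.condMean_asymptotics hα hh hc hh hc hA hV hAV hint hC hS hc0 hcsum).2.2.2
  have h2 : ∀ x : ℝ≥0, (x : ℝ) * (x : ℝ) ^ (α - 1) = (x : ℝ) ^ α := by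
    intro x
    have := Real.rpow_one_add' x.coe_nonneg (y := α - 1) (by linarith)
    rw [← this]
    congr 1
    ring
  simp_rw [h2] at h1
  rwa [← hcsum, mul_assoc, inv_mul_cancel₀ hc0.ne', mul_one] at h1

end Model

/-! ### The weighted adjacency matrix: measurability, moments, scaling by `K^{1/α}` -/

section WeightedAdjacency

variable {Ω : Type*} [MeasurableSpace Ω] {P : Measure Ω} {q d : ℕ} {α : ℝ}

open Classical in
theorem measurable_weightedAdjacency_apply (i : Fin q) (j : Fin d) :
    Measurable fun p : (Fin q → Fin d → ℝ≥0) × (Fin q → Fin d → Prop) =>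
      weightedAdjacency (Matrix.of p.1) p.2 i j := by
  have h1 : MeasurableSet {p : (Fin q → Fin d → ℝ≥0) × (Fin q → Fin d → Prop) | p.2 i j} :=
    measurableSet_setOfPred.2
      ((measurable_pi_apply j).comp ((measurable_pi_apply i).comp measurable_snd))
  have h2 : Measurable fun p : (Fin q → Fin d → ℝ≥0) × (Fin q → Fin d → Prop) => p.1 i j :=
    (measurable_pi_apply j).comp ((measurable_pi_apply i).comp measurable_fst)
  exact Measurable.ite h1 h2 measurable_const

theorem weightedAdjacency_apply_le (w : Matrix (Fin q) (Fin d) ℝ≥0) (e : Fin q → Fin d → Prop)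
    (i : Fin q) (j : Fin d) : weightedAdjacency w e i j ≤ w i j := by
  classical
  rw [weightedAdjacency, Matrix.of_apply]
  split_ifs
  · exact le_rfl
  · exact zero_le

/-- The moment condition on the weights in an arbitrary matrix norm controls the sum of the
entries of the weighted adjacency matrix. -/
theorem integrable_rpow_sum_weightedAdjacency [IsFiniteMeasure P] (hα : 0 ≤ α)
    {W : Ω → Matrix (Fin q) (Fin d) ℝ≥0} {adj : Ω → Fin q → Fin d → Prop}
    {M : Seminorm ℝ (Matrix (Fin q) (Fin d) ℝ)} (hM : ∀ B, M B = 0 → B = 0)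
    {δ : ℝ} (hδ : 0 ≤ δ)
    (hWint : Integrable (fun ω => M ((W ω).map fun w : ℝ≥0 => (w : ℝ)) ^ (α + δ)) P)
    (hA : ∀ i j, Measurable fun ω => weightedAdjacency (W ω) (adj ω) i j) :
    Integrable (fun ω => ((∑ i, ∑ j, weightedAdjacency (W ω) (adj ω) i j : ℝ≥0) : ℝ) ^ α) P := by
  obtain ⟨C, hC, hb⟩ := exists_abs_le_mul_of_definite M hM
    (∑ i, ∑ j, Matrix.entryLinearMap ℝ ℝ i j)
  refine (((integrable_const (1 : ℝ)).add hWint).const_mul (C ^ α)).mono' ?_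
    (ae_of_all _ fun ω => ?_)
  · have : Measurable fun ω => ∑ i, ∑ j, weightedAdjacency (W ω) (adj ω) i j :=
      Finset.measurable_fun_sum _ fun i _ => Finset.measurable_fun_sum _ fun j _ => hA i j
    exact (this.coe_nnreal_real.pow_const α).aestronglyMeasurable
  · set x := M ((W ω).map fun w : ℝ≥0 => (w : ℝ))
    have hx : 0 ≤ x := apply_nonneg M _
    rw [Real.norm_of_nonneg (by positivity)]
    have h1 : ((∑ i, ∑ j, weightedAdjacency (W ω) (adj ω) i j : ℝ≥0) : ℝ) ≤ C * x := by
      refine le_trans ?_ ((le_abs_self _).trans (hb _))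
      have h2 : ∑ i, ∑ j, weightedAdjacency (W ω) (adj ω) i j ≤ ∑ i, ∑ j, W ω i j :=
        Finset.sum_le_sum fun i _ => Finset.sum_le_sum fun j _ =>
          weightedAdjacency_apply_le _ _ i j
      have h3 : ((∑ i, ∑ j, weightedAdjacency (W ω) (adj ω) i j : ℝ≥0) : ℝ) ≤
          (∑ i, ∑ j, W ω i j : ℝ≥0) := by exact_mod_cast h2
      refine h3.trans (le_of_eq ?_)
      simp [LinearMap.sum_apply]
    -- The constant `1` covers `x ≤ 1`, where the higher power is the smaller one.
    have h4 : x ^ α ≤ 1 + x ^ (α + δ) := by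
      rcases le_total x 1 with hx1 | hx1
      · have := Real.rpow_le_one hx hx1 hα
        have := Real.rpow_nonneg hx (α + δ)
        linarith
      · have := Real.rpow_le_rpow_of_exponent_le hx1 (by linarith : α ≤ α + δ)
        linarith
    calc ((∑ i, ∑ j, weightedAdjacency (W ω) (adj ω) i j : ℝ≥0) : ℝ) ^ α ≤ (C * x) ^ α :=
          Real.rpow_le_rpow (NNReal.coe_nonneg _) h1 hα
      _ = C ^ α * x ^ α := Real.mul_rpow hC.le hx
      _ ≤ _ := mul_le_mul_of_nonneg_left h4 (Real.rpow_nonneg hC.le α)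

theorem mul_diagRoot_mulVec (a : Matrix (Fin q) (Fin d) ℝ≥0) (K : Fin d → ℝ≥0)
    (v : Fin d → ℝ≥0) :
    (a * diagRoot K α) *ᵥ v = a *ᵥ fun j => K j ^ (1 / α) * v j := by
  rw [← Matrix.mulVec_mulVec]
  congr 1
  ext j
  rw [diagRoot, Matrix.mulVec_diagonal]

theorem mul_diagRoot_mulVec_single (a : Matrix (Fin q) (Fin d) ℝ≥0) (K : Fin d → ℝ≥0)
    (j : Fin d) :
    (a * diagRoot K α) *ᵥ Pi.single j 1 = a *ᵥ Pi.single j (K j ^ (1 / α)) := by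
  rw [mul_diagRoot_mulVec]
  congr 1
  ext i
  rcases eq_or_ne i j with rfl | hij
  · simp
  · simp [hij]

/-- Homogeneity moves `K_j` inside as `K_j^{1/α}`, matching the ray directions `u_j`. -/
theorem constInd_eq_sum (hα : 0 < α) {A : Ω → Matrix (Fin q) (Fin d) ℝ≥0} {K : Fin d → ℝ≥0}
    {h : (Fin q → ℝ≥0) → ℝ≥0} (hh : PosHomogeneous h) :
    constInd P A K α h = ∑ j, ∫ ω, (h (A ω *ᵥ Pi.single j (K j ^ (1 / α))) : ℝ) ^ α ∂P := by
  refine Finset.sum_congr rfl fun j _ => ?_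
  rw [← integral_const_mul]
  congr 1
  ext ω
  have h1 : (Pi.single j (K j ^ (1 / α)) : Fin d → ℝ≥0) = K j ^ (1 / α) • Pi.single j 1 := by
    rw [← Pi.single_smul, smul_eq_mul, mul_one]
  rw [h1, Matrix.mulVec_smul, hh.smul, NNReal.coe_mul, Real.mul_rpow (by positivity) (by positivity),
    NNReal.coe_rpow, ← Real.rpow_mul (K j).coe_nonneg, one_div_mul_cancel hα.ne', Real.rpow_one]

end WeightedAdjacency

end SystemicRisk

end

/-! ### The theorem -/

open SystemicRisk in
theorem corollary3p6
    {Ω : Type*} [MeasurableSpace Ω] (P : Measure Ω) [IsProbabilityMeasure P] {q d : ℕ}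
    -- the tail index and the tail constants
    (α : ℝ) (hα : 1 < α) (K : Fin d → ℝ≥0) (hK : ∀ j, 0 < K j)
    -- the objects: Pareto tails and multivariate regular variation
    (V : Ω → Fin d → ℝ≥0) (hV : Measurable V)
    (hPareto : ∀ j, Tendsto (fun t : ℝ => P.real {ω | t < (V ω j : ℝ)} / ((K j : ℝ) * t ^ (-α)))
      atTop (𝓝 1))
    (N : Seminorm ℝ (Fin d → ℝ)) (hN : ∀ x, N x = 0 → x = 0)
    (μ : Measure (PuncturedOrthant d)) (hRV : IsRegularlyVarying P N V μ)
    -- the random graph and the weights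
    (W : Ω → Matrix (Fin q) (Fin d) ℝ≥0) (adj : Ω → Fin q → Fin d → Prop)
    (hW : ∀ i j, Measurable fun ω => W ω i j) (hadj : ∀ i j, MeasurableSet {ω | adj ω i j})
    (hWpos : ∀ᵐ ω ∂P, ∀ i j, adj ω i j → 0 < W ω i j)
    (M : Seminorm ℝ (Matrix (Fin q) (Fin d) ℝ)) (hM : ∀ B, M B = 0 → B = 0)
    (δ : ℝ) (hδ : 0 < δ)
    (hWint : Integrable (fun ω => M ((W ω).map fun w : ℝ≥0 => (w : ℝ)) ^ (α + δ)) P)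
    (hindep : IndepFun (fun ω => ((fun i j => W ω i j : Fin q → Fin d → ℝ≥0), adj ω)) V P)
    -- the weighted adjacency matrix and the exposures
    (A : Ω → Matrix (Fin q) (Fin d) ℝ≥0) (hA : ∀ ω, A ω = weightedAdjacency (W ω) (adj ω))
    (F : Ω → Fin q → ℝ≥0) (hF : ∀ ω, F ω = A ω *ᵥ V ω)
    -- the continuous 1-homogeneous functions
    (g h : (Fin q → ℝ≥0) → ℝ≥0) (hg : Continuous g) (hh : Continuous h)
    (hg1 : ∀ (c : ℝ≥0) (x : Fin q → ℝ≥0), 0 < c → g (c • x) = c * g x)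
    (hh1 : ∀ (c : ℝ≥0) (x : Fin q → ℝ≥0), 0 < c → h (c • x) = c * h x) :
    -- (a) asymptotic independence
    (AsymptoticallyIndependent μ → 0 < constInd P A K α h →
      Integrable (fun ω => (g (F ω) : ℝ)) P ∧
      (∀ t : ℝ, P {ω | t < (h (F ω) : ℝ)} ≠ 0) ∧
      (∀ j, Integrable (fun ω => (h (A ω *ᵥ Pi.single j 1) : ℝ) ^ α) P) ∧
      (∀ j, Integrable (fun ω => (g ((A ω * diagRoot K α) *ᵥ Pi.single j 1) : ℝ) *
        (h ((A ω * diagRoot K α) *ᵥ Pi.single j 1) : ℝ) ^ (α - 1)) P) ∧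
      Tendsto (fun t : ℝ =>
          condMean P (fun ω => (g (F ω) : ℝ)) {ω | t < (h (F ω) : ℝ)} / t) atTop
        (𝓝 (α / (α - 1) * (constInd P A K α h)⁻¹ *
          ∑ j, ∫ ω, (g ((A ω * diagRoot K α) *ᵥ Pi.single j 1) : ℝ) *
            (h ((A ω * diagRoot K α) *ᵥ Pi.single j 1) : ℝ) ^ (α - 1) ∂P))) ∧
    -- (b) asymptotic full dependence
    (AsymptoticallyFullyDependent K α μ → 0 < constDep P A K α h →
      Integrable (fun ω => (g (F ω) : ℝ)) P ∧
      (∀ t : ℝ, P {ω | t < (h (F ω) : ℝ)} ≠ 0) ∧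
      Integrable (fun ω => (h ((A ω * diagRoot K α) *ᵥ 1) : ℝ) ^ α) P ∧
      Integrable (fun ω => (g ((A ω * diagRoot K α) *ᵥ 1) : ℝ) *
        (h ((A ω * diagRoot K α) *ᵥ 1) : ℝ) ^ (α - 1)) P ∧
      Tendsto (fun t : ℝ =>
          condMean P (fun ω => (g (F ω) : ℝ)) {ω | t < (h (F ω) : ℝ)} / t) atTop
        (𝓝 (α / (α - 1) * (constDep P A K α h)⁻¹ *
          ∫ ω, (g ((A ω * diagRoot K α) *ᵥ 1) : ℝ) *
            (h ((A ω * diagRoot K α) *ᵥ 1) : ℝ) ^ (α - 1) ∂P))) ∧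
    -- (c) the classical conditional tail expectation, for `g = h`
    ((AsymptoticallyIndependent μ → 0 < constInd P A K α h →
        ClassicalCoTEAsymptotics P (fun ω => (h (F ω) : ℝ)) α (constInd P A K α h)) ∧
      (AsymptoticallyFullyDependent K α μ → 0 < constDep P A K α h →
        ClassicalCoTEAsymptotics P (fun ω => (h (F ω) : ℝ)) α (constDep P A K α h))) := by
  have hα0 : 0 < α := by linarith
  have hg' : PosHomogeneous g := hg1
  have hh' : PosHomogeneous h := hh1
  obtain rfl : A = fun ω => weightedAdjacency (W ω) (adj ω) := funext hA
  obtain rfl : F = fun ω => weightedAdjacency (W ω) (adj ω) *ᵥ V ω := funext hF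
  have hAm : ∀ i j, Measurable fun ω => weightedAdjacency (W ω) (adj ω) i j := fun i j =>
    (measurable_weightedAdjacency_apply i j).comp
      ((measurable_entries hW).prodMk (measurable_pi_lambda _ fun i =>
        measurable_pi_lambda _ fun j => measurableSet_setOfPred.1 (hadj i j)))
  have hAV : IndepFun (fun ω => (fun i j => weightedAdjacency (W ω) (adj ω) i j :
      Fin q → Fin d → ℝ≥0)) V P :=
    hindep.comp (φ := fun p : (Fin q → Fin d → ℝ≥0) × (Fin q → Fin d → Prop) =>
        (fun i j => weightedAdjacency (Matrix.of p.1) p.2 i j : Fin q → Fin d → ℝ≥0)) (ψ := id)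
      (measurable_entries fun i j => measurable_weightedAdjacency_apply i j) measurable_id
  have hint := integrable_rpow_sum_weightedAdjacency hα0.le hM hδ.le hWint hAm
  have htail : ∀ j, Tendsto (fun t : ℝ => t ^ α * P.real {ω | t < (V ω j : ℝ)}) atTop
      (𝓝 (K j)) := fun j =>
    tendsto_tail_of_div_tendsto_one (by exact_mod_cast (hK j).ne') (hPareto j)
  obtain ⟨C, hC, hS⟩ := exists_sum_tail_bound hα0 htail
  have hray : AsymptoticallyIndependent μ → RayApproximation P α V
      (fun j ω => V ω j / K j ^ (1 / α)) (fun j => Pi.single j (K j ^ (1 / α))) := fun hμ =>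
    hRV.rayApproximation_of_asymptoticallyIndependent hα0 hV hK htail hN hμ
  -- Any coordinate can serve as the radial variable under full dependence.
  obtain ⟨j₀⟩ := hRV.nonempty
  have hdiag : AsymptoticallyFullyDependent K α μ → RayApproximation P α V
      (fun (_ : Unit) ω => V ω j₀ / K j₀ ^ (1 / α)) (fun _ i => K i ^ (1 / α)) := fun hμ =>
    hRV.rayApproximation_of_asymptoticallyFullyDependent hα0 hV hK htail hN hμ j₀
  have hone : ∀ a : Matrix (Fin q) (Fin d) ℝ≥0,
      (a * diagRoot K α) *ᵥ 1 = a *ᵥ fun i => K i ^ (1 / α) := fun a => by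
    rw [mul_diagRoot_mulVec]
    simp only [Pi.one_apply, mul_one]
  have hInd : constInd P (fun ω => weightedAdjacency (W ω) (adj ω)) K α h =
      ∑ j, ∫ ω, (h (weightedAdjacency (W ω) (adj ω) *ᵥ Pi.single j (K j ^ (1 / α))) : ℝ) ^ α ∂P :=
    constInd_eq_sum hα0 hh'
  have hDep : constDep P (fun ω => weightedAdjacency (W ω) (adj ω)) K α h =
      ∑ _j : Unit, ∫ ω,
        (h (weightedAdjacency (W ω) (adj ω) *ᵥ fun i => K i ^ (1 / α)) : ℝ) ^ α ∂P := by
    simp only [constDep, hone, Finset.univ_unique, Finset.sum_singleton]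
  refine ⟨fun hμ hpos => ?_, fun hμ hpos => ?_, fun hμ hpos => ?_, fun hμ hpos => ?_⟩
  · obtain ⟨h1, h2, h3, h4⟩ := (hray hμ).condMean_asymptotics hα hg' hg hh' hh hAm hV hAV hint
      hC hS hpos hInd
    simp only [mul_diagRoot_mulVec_single]
    exact ⟨h1, h2, fun j => integrable_rpow_apply_mulVec hα0.le hh' hh hAm hint _, h3, h4⟩
  · obtain ⟨h1, h2, h3, h4⟩ := (hdiag hμ).condMean_asymptotics hα hg' hg hh' hh hAm hV hAV hint
      hC hS hpos hDep
    simp only [Finset.univ_unique, Finset.sum_singleton] at h4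
    simp only [hone]
    exact ⟨h1, h2, integrable_rpow_apply_mulVec hα0.le hh' hh hAm hint _, h3 (), h4⟩
  · exact (hray hμ).classicalCoTEAsymptotics hα hh' hh hAm hV hAV hint hC hS hpos hInd
  · exact (hdiag hμ).classicalCoTEAsymptotics hα hh' hh hAm hV hAV hint hC hS hpos hDep
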